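/- Let $\mathcal A$ be a von Neumann algebra acting on a Hilbert space $H$, with a faithful state $\phi$, and let $\mathcal A\otimes\mathcal A$ be the von Neumann tensor product, acting on $H\otimes H$. Let $\{\xi_n,\eta_n : n\ge 1\}\subset\mathcal A$ be a free family of standard semicircular variables (self-adjoint, with law $\frac1{2\pi}\sqrt{4-t^2}\,\mathbf 1_{[-2,2]}(t)\,dt$; freeness means freeness of the von Neumann algebras generated by the individual variables). For $t\in[0,2\pi]$ put $$\beta(t)=\sum_{n=1}^\infty\frac{\cos(nt)-1}{n\sqrt\pi}\,\xi_n+\sum_{n=1}^\infty\frac{\sin(nt)}{n\sqrt\pi}\,\eta_n .$$ Then both series converge (unconditionally) in norm, and $\beta$ is a free Brownian bridge on $[0,2\pi]$, i.e. a centred semicircular process with $\phi(\beta(s)\beta(t))=s\wedge t-\frac{st}{2\pi}$. The second component of its signature at time $2\pi$, $$Z(2\pi)=\int_0^{2\pi}\beta\otimes d\beta ,$$ exists as the limit, in the norm of $\mathcal A\otimes\mathcal A$ and as the mesh of the partition $0=t_0\le t_1\le\dots\le t_N=2\pi$ tends to $0$, of the Riemann sums $\sum_{k<N}\beta(t_k)\otimes(\beta(t_{k+1})-\beta(t_k))$,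 and $$Z(2\pi)=\sum_{n=1}^\infty\frac1n\left(\xi_n\otimes\eta_n-\eta_n\otimes\xi_n\right),$$ where the series converges (unconditionally) in the norm of $\mathcal A\otimes\mathcal A$. -/

import Mathlib

open scoped TensorProduct InnerProductSpace

noncomputable section

namespace FreeBridge

universe u

/-! ### Von Neumann algebras -/

section VonNeumann

variable {H : Type u} [NormedAddCommGroup H] [InnerProductSpace ℂ H] [CompleteSpace H]

/-- The von Neumann algebra generated by a set `S` of bounded operators: the double commutant of
`S ∪ S⋆`. -/
def vonNeumannClosure (S : Set (H →L[ℂ] H)) : VonNeumannAlgebra H where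
  toStarSubalgebra := StarSubalgebra.centralizer ℂ (StarSubalgebra.centralizer ℂ S : Set (H →L[ℂ] H))
  centralizer_centralizer' := by
    have key : ∀ T : StarSubalgebra ℂ (H →L[ℂ] H),
        (T : Set (H →L[ℂ] H)) ∪ star (T : Set (H →L[ℂ] H)) = T := by
      intro T
      apply Set.union_eq_self_of_subset_right
      intro x hx
      have h := T.star_mem' hx
      simpa using h
    change Set.centralizer (Set.centralizer (StarSubalgebra.centralizer ℂ
      (StarSubalgebra.centralizer ℂ S : Set (H →L[ℂ] H)) : Set (H →L[ℂ] H))) =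
      (StarSubalgebra.centralizer ℂ (StarSubalgebra.centralizer ℂ S : Set (H →L[ℂ] H)) :
        Set (H →L[ℂ] H))
    rw [StarSubalgebra.coe_centralizer, key, Set.centralizer_centralizer_centralizer]

theorem subset_vonNeumannClosure (S : Set (H →L[ℂ] H)) {x : H →L[ℂ] H} (hx : x ∈ S) :
    x ∈ (vonNeumannClosure S).toStarSubalgebra := by
  change x ∈ (StarSubalgebra.centralizer ℂ
    (StarSubalgebra.centralizer ℂ S : Set (H →L[ℂ] H)) : StarSubalgebra ℂ (H →L[ℂ] H))
  rw [StarSubalgebra.mem_centralizer_iff]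
  intro g hg
  have hg' := (StarSubalgebra.mem_centralizer_iff ℂ).1 hg x hx
  refine ⟨hg'.1.symm, ?_⟩
  have h2 := congrArg star hg'.2
  simpa using h2

/-- The Hilbert space tensor product `H ⊗ H`. -/
abbrev HilbertTensor (H : Type u) [NormedAddCommGroup H] [InnerProductSpace ℂ H] : Type u :=
  UniformSpace.Completion (H ⊗[ℂ] H)

/-- The bounded operator `a ⊗ b` on the Hilbert space tensor product, determined by
`(a ⊗ b) (x ⊗ y) = a x ⊗ b y`. -/
def tensorOp (a b : H →L[ℂ] H) : HilbertTensor H →L[ℂ] HilbertTensor H :=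
  (TensorProduct.mapL a b).completion

end VonNeumann

/-! ### Non-commutative probability spaces -/

/-- A non-commutative probability space: a von Neumann algebra acting on a Hilbert space `H`,
together with a state. -/
structure NCProbSpace (H : Type u) [NormedAddCommGroup H] [InnerProductSpace ℂ H]
    [CompleteSpace H] where
  /-- the von Neumann algebra -/
  alg : VonNeumannAlgebra H
  /-- the expectation -/
  state : alg.toStarSubalgebra →ₗ[ℂ] ℂ
  state_one : state 1 = 1
  state_nonneg : ∀ a : alg.toStarSubalgebra, ∃ r : ℝ, 0 ≤ r ∧ state (star a * a) = (r : ℂ)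

namespace NCProbSpace

variable {H : Type u} [NormedAddCommGroup H] [InnerProductSpace ℂ H] [CompleteSpace H]

/-- The random variables of a non-commutative probability space, i.e. the elements of the
von Neumann algebra, with the operator norm. -/
abbrev Var (𝒜 : NCProbSpace H) : Type u := 𝒜.alg.toStarSubalgebra

/-- The state is faithful. -/
def IsFaithful (𝒜 : NCProbSpace H) : Prop :=
  ∀ a : 𝒜.Var, 𝒜.state (star a * a) = 0 → a = 0

/-- Von Neumann subalgebras `B i` are free: an alternating product of `m ≥ 1` centred elements is
centred. -/
def FreeAlgebras (𝒜 : NCProbSpace H) {ι : Type*} (B : ι → VonNeumannAlgebra H) : Prop :=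
  ∀ w : List (ι × 𝒜.Var), w ≠ [] →
    w.IsChain (fun p q => p.1 ≠ q.1) →
    (∀ p ∈ w, (p.2 : H →L[ℂ] H) ∈ B p.1 ∧ 𝒜.state p.2 = 0) →
    𝒜.state (w.map Prod.snd).prod = 0

/-- Random variables are free if the von Neumann algebras that they generate are free. -/
def Free (𝒜 : NCProbSpace H) {ι : Type*} (a : ι → 𝒜.Var) : Prop :=
  𝒜.FreeAlgebras (fun i => vonNeumannClosure {(a i : H →L[ℂ] H)})

/-- `μ` is the distribution of the self-adjoint variable `a`: it has bounded support and the
moments of `a`. -/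
def HasDistribution (𝒜 : NCProbSpace H) (a : 𝒜.Var) (μ : MeasureTheory.Measure ℝ) : Prop :=
  IsSelfAdjoint a ∧ (∃ R : ℝ, μ (Set.Icc (-R) R)ᶜ = 0) ∧
    ∀ n : ℕ, 𝒜.state (a ^ n) = ((∫ t, t ^ n ∂μ : ℝ) : ℂ)

end NCProbSpace

/-- The centred semicircle law of radius `r`, with density
`2 / (π r²) * √(r² - t²)` on `[-r, r]`. -/
def semicircleLaw (r : ℝ) : MeasureTheory.Measure ℝ :=
  MeasureTheory.volume.withDensity fun t =>
    ENNReal.ofReal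
      ((Set.Icc (-r) r).indicator (fun t => 2 / (Real.pi * r ^ 2) * √(r ^ 2 - t ^ 2)) t)

/-- The non-crossing pair partitions of `{0, …, n - 1}`, each encoded by the fixed-point free
involution that interchanges the two elements of every block. -/
def ncPairings (n : ℕ) : Finset (Equiv.Perm (Fin n)) :=
  open Classical in
  Finset.univ.filter fun π =>
    (∀ i, π (π i) = i) ∧ (∀ i, π i ≠ i) ∧ ¬ ∃ i j, i < j ∧ j < π i ∧ π i < π j

namespace NCProbSpace

variable {H : Type u} [NormedAddCommGroup H] [InnerProductSpace ℂ H] [CompleteSpace H]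

/-- `a` is a standard semicircular variable: its distribution is the semicircle law of radius 2. -/
def IsStandardSemicircular (𝒜 : NCProbSpace H) (a : 𝒜.Var) : Prop :=
  𝒜.HasDistribution a (semicircleLaw 2)

/-- `s` is a (centred) semicircular family with covariance `c`: the only non-zero free cumulants
are those of order two, and these are given by `c`. By the moment-cumulant formula this says that
every mixed moment is the sum over non-crossing pair partitions of the products of the covariances
over the blocks. -/
def IsSemicircularFamily (𝒜 : NCProbSpace H) {ι : Type*} (s : ι → 𝒜.Var) (c : ι → ι → ℝ) : Prop :=
  (∀ i, IsSelfAdjoint (s i)) ∧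
    ∀ (n : ℕ) (j : Fin n → ι),
      𝒜.state (List.ofFn fun k => s (j k)).prod =
        ((∑ π ∈ ncPairings n,
          ∏ p ∈ Finset.univ.filter (fun p => p < π p), c (j p) (j (π p)) : ℝ) : ℂ)

/-- `β` is a free Brownian bridge on `[0, T]`: a centred semicircular process with covariance
`min s t - s t / T`. -/
def IsFreeBrownianBridge (𝒜 : NCProbSpace H) (T : ℝ) (β : ℝ → 𝒜.Var) : Prop :=
  𝒜.IsSemicircularFamily (fun t : Set.Icc (0 : ℝ) T => β t)
    (fun s t => min (s : ℝ) t - (s : ℝ) * t / T)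

/-! ### The tensor product and the second component of the signature -/

/-- The von Neumann tensor product of the algebra with itself, acting on `H ⊗ H`. -/
def tensorAlg (𝒜 : NCProbSpace H) : VonNeumannAlgebra (HilbertTensor H) :=
  vonNeumannClosure {x | ∃ a b : 𝒜.Var, x = tensorOp (a : H →L[ℂ] H) (b : H →L[ℂ] H)}

/-- The elements of the von Neumann tensor product, with the operator norm. -/
abbrev TensorVar (𝒜 : NCProbSpace H) : Type u := 𝒜.tensorAlg.toStarSubalgebra

/-- The elementary tensor `a ⊗ b`. -/
def tmul (𝒜 : NCProbSpace H) (a b : 𝒜.Var) : 𝒜.TensorVar :=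
  ⟨tensorOp (a : H →L[ℂ] H) (b : H →L[ℂ] H), subset_vonNeumannClosure _ ⟨a, b, rfl⟩⟩

/-- `Z` is the stochastic integral `∫_a^b α ⊗ dβ`: the limit, in the norm of the von Neumann tensor
product and as the mesh of the partition `a = τ 0 ≤ τ 1 ≤ ⋯ ≤ τ n = b` tends to zero, of the
(non-anticipating) Riemann sums `∑ k, α (τ k) ⊗ (β (τ (k + 1)) - β (τ k))`. -/
def HasTensorIntegral (𝒜 : NCProbSpace H) (α β : ℝ → 𝒜.Var) (a b : ℝ) (Z : 𝒜.TensorVar) : Prop :=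
  ∀ ε > 0, ∃ δ > 0, ∀ (n : ℕ) (τ : ℕ → ℝ), Monotone τ → τ 0 = a → τ n = b →
    (∀ k < n, τ (k + 1) - τ k < δ) →
    ‖(∑ k ∈ Finset.range n, 𝒜.tmul (α (τ k)) (β (τ (k + 1)) - β (τ k))) - Z‖ < ε

/-- `Z` is the second component `∫_0^t β ⊗ dβ` of the signature of `β` at time `t`. -/
def IsSecondSignature (𝒜 : NCProbSpace H) (β : ℝ → 𝒜.Var) (t : ℝ) (Z : 𝒜.TensorVar) : Prop :=
  𝒜.HasTensorIntegral β β 0 t Z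

/-! ### The Lévy representation -/

/-- The term `(cos (n t) - 1) / (n √π) ξ_n`. -/
def levyCosTerm (𝒜 : NCProbSpace H) (ξ : ℕ+ → 𝒜.Var) (t : ℝ) (n : ℕ+) : 𝒜.Var :=
  (((Real.cos (n * t) - 1) / (n * √Real.pi) : ℝ) : ℂ) • ξ n

/-- The term `sin (n t) / (n √π) η_n`. -/
def levySinTerm (𝒜 : NCProbSpace H) (η : ℕ+ → 𝒜.Var) (t : ℝ) (n : ℕ+) : 𝒜.Var :=
  ((Real.sin (n * t) / (n * √Real.pi) : ℝ) : ℂ) • η n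

/-- The process given by Lévy's series. -/
def levyBridge (𝒜 : NCProbSpace H) (ξ η : ℕ+ → 𝒜.Var) (t : ℝ) : 𝒜.Var :=
  ∑' n, 𝒜.levyCosTerm ξ t n + ∑' n, 𝒜.levySinTerm η t n

end NCProbSpace

end FreeBridge

end

set_option linter.unusedSectionVars false

noncomputable section

namespace FreeBridge

/-! ### The algebraic Fock space -/

section Fock

variable {ι : Type*}

/-! Everything is reduced to finite linear combinations of the variables and to two facts about
them: their mixed moments and a norm inequality.

Freeness and the semicircle law enter only through `NCProbSpace.Free.isFockFamily`. The polynomial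
attached to a nonempty word is an alternating product of Chebyshev polynomials, which are centred
for the semicircle law, so the state kills it. Left multiplication by a variable acts on these
polynomials as creation plus annihilation on words (`mul_fockMap`), so the state of a product of
variables is the vacuum coefficient of the corresponding vector of Fock space.

For the moments, the first field operator, read at the vacuum, is traded for a right annihilation
operator, which is then moved through the remaining factors. This gives the recursion that sums over
non-crossing pairings satisfy when split at the partner of the first point (`ncSum_add_two`), hence
`IsFockFamily.moment`. The bridge inherits the formula in the limit, its covariance being summed
from the Fourier series of the second Bernoulli polynomial.

For the norms, creation and annihilation with matrix coefficients T_i are each bounded on Fock space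
by the square root of the sum of ‖T_i‖². As the state is faithful, norms can be read off from
moments, and `norm_matrixComb_le` gives ‖∑ s_i ⊗ T_i‖ ≤ 2 (∑ ‖T_i‖²)^(1/2). Compressing the second
leg to finite dimensions extends this to arbitrary operators T_i on H. Taking T_i = ∑ M_ij s_j and
using the scalar case once more bounds ‖∑ M_ij s_i ⊗ s_j‖ by four times the Hilbert-Schmidt norm of
M.

The integral thus becomes a question about real matrices. The coefficient functions f_i have
derivatives e_i orthonormal in L²[0, 2π], and the Riemann sums of ∫ f_i df_j err by minus the
integral of (f_i - f_i(τ_k)) e_j. Bessel's inequality in j, followed by ∑_i (f_i(u) - f_i(τ_k))² ≤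
|u - τ_k|, bounds the squared Hilbert-Schmidt error by 2π times the mesh (`sum_levyArea_sub_sq_le`),
uniformly in the truncation. The matrix ∫ f_i df_j itself consists of the entries ±1/n. -/

/-- The algebraic full Fock space over the free vector space on `ι`; its basis are the words. -/
abbrev Fock (ι : Type*) : Type _ := List ι →₀ ℂ

/-- The left creation operator. -/
def creation (i : ι) : Fock ι →ₗ[ℂ] Fock ι :=
  Finsupp.lmapDomain ℂ ℂ (List.cons i)

/-- The left annihilation operator. -/
def annihilation (i : ι) : Fock ι →ₗ[ℂ] Fock ι :=
  Finsupp.lcomapDomain (List.cons i) List.cons_injective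

/-- The right annihilation operator. -/
def rightAnnihilation (i : ι) : Fock ι →ₗ[ℂ] Fock ι :=
  Finsupp.lcomapDomain (fun w => w ++ [i]) (List.append_left_injective [i])

/-- The semicircular operator `l_i + l_i⋆`. -/
def fieldOp (i : ι) : Fock ι →ₗ[ℂ] Fock ι := creation i + annihilation i

/-- The vacuum vector. -/
def vacuum (ι : Type*) : Fock ι := Finsupp.single [] 1

theorem creation_single (i : ι) (w : List ι) (z : ℂ) :
    creation i (Finsupp.single w z) = Finsupp.single (i :: w) z := by
  simp [creation]

theorem annihilation_apply (i : ι) (v : Fock ι) (w : List ι) :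
    annihilation i v w = v (i :: w) := rfl

theorem rightAnnihilation_apply (i : ι) (v : Fock ι) (w : List ι) :
    rightAnnihilation i v w = v (w ++ [i]) := rfl

theorem creation_apply_nil (i : ι) (v : Fock ι) : creation i v [] = 0 :=
  Finsupp.mapDomain_of_notMem_range _ _ (by simp)

theorem rightAnnihilation_vacuum (i : ι) : rightAnnihilation i (vacuum ι) = 0 := by
  ext w
  simp [rightAnnihilation_apply, vacuum]

variable [DecidableEq ι]

theorem creation_apply_cons (i j : ι) (v : Fock ι) (w : List ι) :
    creation i v (j :: w) = if i = j then v w else 0 := by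
  split_ifs with h
  · subst h
    exact Finsupp.mapDomain_apply List.cons_injective _ _
  · exact Finsupp.mapDomain_of_notMem_range _ _ (by simp [h])

theorem fieldOp_apply_nil (i : ι) (v : Fock ι) : fieldOp i v [] = v [i] := by
  simp [fieldOp, creation_apply_nil, annihilation_apply]

theorem fieldOp_apply_cons (i j : ι) (v : Fock ι) (w : List ι) :
    fieldOp i v (j :: w) = (if i = j then v w else 0) + v (i :: j :: w) := by
  simp [fieldOp, creation_apply_cons, annihilation_apply]

/-- A left operator changes the first letter and a right one the last, so they commute except where
a letter is created on the empty word: it is then first and last at once. -/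
theorem rightAnnihilation_fieldOp (i j : ι) (v : Fock ι) :
    rightAnnihilation i (fieldOp j v) =
      fieldOp j (rightAnnihilation i v) + (if j = i then v [] else 0) • vacuum ι := by
  ext w
  by_cases hij : j = i
  · cases w <;> simp [rightAnnihilation_apply, fieldOp_apply_nil, fieldOp_apply_cons, vacuum,
      hij, add_comm]
  · cases w <;> simp [rightAnnihilation_apply, fieldOp_apply_nil, fieldOp_apply_cons, hij]

variable {A : Type*} [Ring A] [Algebra ℂ A]

/-- The orthogonal polynomials of free semicircular variables, indexed by words: products of
Chebyshev polynomials over the runs of the word. -/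
def wordPoly (s : ι → A) : List ι → A
  | [] => 1
  | [i] => s i
  | i :: j :: w => s i * wordPoly s (j :: w) - if i = j then wordPoly s w else 0

/-- The map `e_w ↦ U_w(s)`. -/
def fockMap (s : ι → A) : Fock ι →ₗ[ℂ] A := Finsupp.linearCombination ℂ (wordPoly s)

theorem fockMap_vacuum (s : ι → A) : fockMap s (vacuum ι) = 1 := by
  simp [fockMap, vacuum, wordPoly]

/-- The recursion defining `wordPoly` is exactly this intertwining relation: the subtracted term is
what annihilation puts back. -/
theorem mul_fockMap (s : ι → A) (i : ι) (v : Fock ι) :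
    s i * fockMap s v = fockMap s (fieldOp i v) := by
  induction v using Finsupp.induction_linear with
  | zero => simp
  | add f g hf hg => simp [mul_add, hf, hg]
  | single w z =>
    have h : annihilation i (Finsupp.single w z) =
        match w with
        | [] => 0
        | j :: w' => if i = j then Finsupp.single w' z else 0 := by
      ext u
      rw [annihilation_apply]
      cases w with
      | nil => simp
      | cons j w' =>
        by_cases hij : i = j
        · subst hij; simp [Finsupp.single_apply]
        · simp [hij]
    rw [fieldOp, LinearMap.add_apply, creation_single, h]
    cases w with
    | nil => simp [fockMap, wordPoly]
    | cons j w' =>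
      by_cases hij : i = j
      · subst hij; simp [fockMap, wordPoly, smul_sub]
      · simp [fockMap, wordPoly, hij]

/-- The family `s` has the joint distribution, with respect to `φ`, of free standard semicircular
variables, expressed by the orthogonality of the polynomials `wordPoly`. -/
def IsFockFamily (φ : A →ₗ[ℂ] ℂ) (s : ι → A) : Prop :=
  ∀ w, φ (wordPoly s w) = if w = [] then 1 else 0

theorem IsFockFamily.apply_fockMap {φ : A →ₗ[ℂ] ℂ} {s : ι → A} (h : IsFockFamily φ s)
    (v : Fock ι) : φ (fockMap s v) = v [] := by
  induction v using Finsupp.induction_linear with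
  | zero => simp
  | add f g hf hg => simp [hf, hg]
  | single w z => simp [fockMap, h w, Finsupp.single_apply]

/-! ### Linear combinations of the variables -/

variable (F : Finset ι)

/-- `∑ g_i s_i`. -/
def linComb (s : ι → A) (g : ι → ℝ) : A := ∑ i ∈ F, (g i : ℂ) • s i

/-- `∑ g_i (l_i + l_i⋆)`. -/
def linField (g : ι → ℝ) : Fock ι →ₗ[ℂ] Fock ι := ∑ i ∈ F, (g i : ℂ) • fieldOp i

/-- `∑ g_i r_i⋆`. -/
def linRight (g : ι → ℝ) : Fock ι →ₗ[ℂ] Fock ι := ∑ i ∈ F, (g i : ℂ) • rightAnnihilation i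

theorem linComb_mul_fockMap (s : ι → A) (g : ι → ℝ) (v : Fock ι) :
    linComb F s g * fockMap s v = fockMap s (linField F g v) := by
  simp [linComb, linField, Finset.sum_mul, mul_fockMap]

theorem linRight_linField (g h : ι → ℝ) (v : Fock ι) :
    linRight F g (linField F h v) =
      linField F h (linRight F g v) + (((∑ i ∈ F, g i * h i : ℝ) : ℂ) * v []) • vacuum ι := by
  simp only [linRight, linField, LinearMap.sum_apply, LinearMap.smul_apply, map_sum, map_smul,
    rightAnnihilation_fieldOp, smul_add, Finset.sum_add_distrib, Finset.smul_sum]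
  rw [Finset.sum_comm]
  congr 1
  · refine Finset.sum_congr rfl fun i _ => Finset.sum_congr rfl fun j _ => ?_
    rw [smul_comm]
  · simp only [smul_smul, ← Finset.sum_smul]
    congr 1
    push_cast
    rw [Finset.sum_mul, Finset.sum_comm]
    refine Finset.sum_congr rfl fun i hi => ?_
    rw [Finset.sum_eq_single i]
    · simp; ring
    · intro b _ hb; simp [hb]
    · exact fun h => absurd hi h

theorem linRight_vacuum (g : ι → ℝ) : linRight F g (vacuum ι) = 0 := by
  simp [linRight, rightAnnihilation_vacuum]

/-- Only one-letter words contribute at the empty word, and for these left and right annihilation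
agree. -/
theorem linField_apply_nil (g : ι → ℝ) (v : Fock ι) :
    linField F g v [] = linRight F g v [] := by
  simp [linField, linRight, fieldOp_apply_nil, rightAnnihilation_apply, Finsupp.finsetSum_apply]

/-- The vector `x_a x_{a+1} ⋯ x_{a+n-1} Ω`. -/
def fockWord (g : ℕ → ι → ℝ) : ℕ → ℕ → Fock ι
  | _, 0 => vacuum ι
  | a, n + 1 => linField F (g a) (fockWord g (a + 1) n)

/-- The right annihilation operator is moved through the factors until it dies on the vacuum. Each
commutator is of rank one, so it cuts the product: the factors to its right contribute only their
vacuum coefficient, and those to its left act afresh on the vacuum. -/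
theorem linRight_fockWord (g : ℕ → ι → ℝ) (h : ι → ℝ) (n a : ℕ) :
    linRight F h (fockWord F g a (n + 1)) =
      ∑ p ∈ Finset.HasAntidiagonal.antidiagonal n,
        (((∑ i ∈ F, h i * g (a + p.1) i : ℝ) : ℂ) * fockWord F g (a + p.1 + 1) p.2 []) •
          fockWord F g a p.1 := by
  induction n generalizing a with
  | zero => simp [fockWord, linRight_linField, linRight_vacuum]
  | succ n ih =>
    rw [fockWord, linRight_linField, ih, Finset.Nat.antidiagonal_succ, Finset.sum_cons,
      Finset.sum_map, map_sum, add_comm]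
    congr 1
    refine Finset.sum_congr rfl fun p _ => ?_
    simp only [map_smul, Function.Embedding.prodMap, Function.Embedding.coeFn_mk, Prod.map,
      Function.Embedding.refl_apply, Nat.succ_eq_add_one, fockWord]
    rw [show a + 1 + p.1 = a + (p.1 + 1) by ring]

theorem fockWord_add_two_apply_nil (g : ℕ → ι → ℝ) (n a : ℕ) :
    fockWord F g a (n + 2) [] =
      ∑ p ∈ Finset.HasAntidiagonal.antidiagonal n,
        ((∑ i ∈ F, g a i * g (a + 1 + p.1) i : ℝ) : ℂ) *
          fockWord F g (a + 1) p.1 [] * fockWord F g (a + p.1 + 2) p.2 [] := by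
  rw [fockWord, linField_apply_nil, linRight_fockWord, Finsupp.finsetSum_apply]
  refine Finset.sum_congr rfl fun p _ => ?_
  rw [Finsupp.smul_apply, smul_eq_mul, show a + 1 + p.1 + 1 = a + p.1 + 2 by ring]
  ring

theorem fockWord_one_apply_nil (g : ℕ → ι → ℝ) (a : ℕ) : fockWord F g a 1 [] = 0 := by
  simp [fockWord, linField_apply_nil, linRight_vacuum]

theorem fockWord_zero_apply_nil (g : ℕ → ι → ℝ) (a : ℕ) : fockWord F g a 0 [] = 1 := by
  simp [fockWord, vacuum]

theorem fockMap_fockWord (s : ι → A) (g : ℕ → ι → ℝ) (n a : ℕ) :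
    fockMap s (fockWord F g a n) = (List.ofFn fun k : Fin n => linComb F s (g (a + k))).prod := by
  induction n generalizing a with
  | zero => simp [fockWord, fockMap_vacuum]
  | succ n ih =>
    rw [fockWord, ← linComb_mul_fockMap, ih, List.ofFn_succ, List.prod_cons]
    simp [add_assoc, add_comm 1]

end Fock

/-! ### Non-crossing pairings of intervals -/

section Pairings

/-- `f` is a non-crossing pairing of `{a, …, a + n - 1}`, extended by the identity. -/
structure IsNCPairing (a n : ℕ) (f : ℕ → ℕ) : Prop where
  fix : ∀ i, i < a ∨ a + n ≤ i → f i = i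
  invol : ∀ i, f (f i) = i
  ne : ∀ i, a ≤ i → i < a + n → f i ≠ i
  nc : ∀ i j, i < j → j < f i → ¬ f i < f j

namespace IsNCPairing

variable {a n : ℕ} {f : ℕ → ℕ}

theorem mem (h : IsNCPairing a n f) {i : ℕ} (h1 : a ≤ i) (h2 : i < a + n) :
    a ≤ f i ∧ f i < a + n := by
  by_contra hc
  have h3 := h.fix (f i) (by omega)
  rw [h.invol] at h3
  exact h.ne i h1 h2 h3.symm

end IsNCPairing

theorem finite_isNCPairing (a n : ℕ) : {f | IsNCPairing a n f}.Finite := by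
  rw [Set.finite_coe_iff.symm]
  refine Finite.of_injective (β := Fin n → Fin (a + n))
    (fun f k => ⟨f.1 (a + k), (f.2.mem (by omega) (by omega)).2⟩) ?_
  rintro ⟨f, hf⟩ ⟨g, hg⟩ hfg
  ext i
  by_cases hi : i < a ∨ a + n ≤ i
  · exact (hf.fix i hi).trans (hg.fix i hi).symm
  · have := congrArg Fin.val (congrFun hfg ⟨i - a, by omega⟩)
    simpa [show a + (i - a) = i by omega] using this

/-- The non-crossing pairings of `{a, …, a + n - 1}`. -/
def ncFuns (a n : ℕ) : Finset (ℕ → ℕ) := (finite_isNCPairing a n).toFinset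

theorem mem_ncFuns {a n : ℕ} {f : ℕ → ℕ} : f ∈ ncFuns a n ↔ IsNCPairing a n f := by
  simp [ncFuns]

/-- The product of `c` over the blocks of the pairing `f`. -/
def ncWeight (c : ℕ → ℕ → ℝ) (a n : ℕ) (f : ℕ → ℕ) : ℝ :=
  ∏ i ∈ Finset.Ico a (a + n), if i < f i then c i (f i) else 1

/-- Insert the block `{a, a + k + 1}` around `f` and before `g`. -/
def ncGlue (a k : ℕ) (f g : ℕ → ℕ) (i : ℕ) : ℕ :=
  if i = a then a + 1 + k else if i = a + 1 + k then a else if i ≤ a + k then f i else g i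

theorem isNCPairing_ncGlue {a k l : ℕ} {f g : ℕ → ℕ} (hf : IsNCPairing (a + 1) k f)
    (hg : IsNCPairing (a + k + 2) l g) : IsNCPairing a (k + l + 2) (ncGlue a k f g) := by
  have f1 : ∀ i, i < a + 1 ∨ a + 1 + k ≤ i → f i = i := hf.fix
  have g1 : ∀ i, i < a + k + 2 ∨ a + k + 2 + l ≤ i → g i = i := hg.fix
  have f2 : ∀ i, a + 1 ≤ i → i < a + 1 + k → a + 1 ≤ f i ∧ f i < a + 1 + k :=
    fun i => hf.mem
  have g2 : ∀ i, a + k + 2 ≤ i → i < a + k + 2 + l → a + k + 2 ≤ g i ∧ g i < a + k + 2 + l :=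
    fun i => hg.mem
  refine ⟨fun i hi => ?_, fun i => ?_, fun i h1 h2 => ?_, fun i j hij => ?_⟩
  · have := f1 i; have := g1 i
    unfold ncGlue; split_ifs <;> omega
  · have := f1 i; have := g1 i; have := f2 i; have := g2 i
    have := hf.invol i; have := hg.invol i
    unfold ncGlue
    split_ifs <;> omega
  · have := f2 i; have := g2 i; have := hf.ne i; have := hg.ne i
    unfold ncGlue
    split_ifs <;> omega
  · have := f1 i; have := g1 i; have := f2 i; have := g2 i
    have := f1 j; have := g1 j; have := f2 j; have := g2 j
    have := hf.nc i j hij; have := hg.nc i j hij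
    unfold ncGlue
    split_ifs <;> omega

/-- The part of `h` inside the block of `a`. -/
def ncInner (a : ℕ) (h : ℕ → ℕ) (i : ℕ) : ℕ := if a < i ∧ i < h a then h i else i

/-- The part of `h` after the block of `a`. -/
def ncOuter (a : ℕ) (h : ℕ → ℕ) (i : ℕ) : ℕ := if h a < i then h i else i

section Split

variable {a n : ℕ} {h : ℕ → ℕ} (hh : IsNCPairing a (n + 2) h)
include hh

theorem IsNCPairing.lt_first : a < h a ∧ h a < a + n + 2 := by
  have h1 := hh.mem (i := a) le_rfl (by omega)
  have h2 := hh.ne a le_rfl (by omega)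
  omega

/-- A partner outside would make the block of `i` cross the block of `a`. -/
theorem IsNCPairing.mem_inner {i : ℕ} (h1 : a < i) (h2 : i < h a) : a < h i ∧ h i < h a := by
  have := hh.lt_first
  have h3 := hh.mem (i := i) h1.le (by omega)
  have h4 : h i ≠ a := fun e => by have := hh.invol i; rw [e] at this; omega
  have h5 : h i ≠ h a := fun e => by
    have := hh.invol i; rw [e, hh.invol] at this; omega
  have h6 := hh.nc a i h1 h2
  omega

theorem IsNCPairing.mem_outer {i : ℕ} (h1 : h a < i) : h a < h i := by
  by_contra hc
  have := hh.lt_first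
  have h4 : h i ≠ a := fun e => by have := hh.invol i; rw [e] at this; omega
  have h5 : h i ≠ h a := fun e => by
    have := hh.invol i; rw [e, hh.invol] at this; omega
  have h6 : a < h i := by
    by_contra h7
    have h8 := hh.fix (h i) (by omega)
    rw [hh.invol] at h8
    omega
  have h7 := hh.mem_inner h6 (by omega)
  rw [hh.invol] at h7
  omega

theorem isNCPairing_ncInner : IsNCPairing (a + 1) (h a - a - 1) (ncInner a h) := by
  have h0 := hh.lt_first
  refine ⟨fun i hi => ?_, fun i => ?_, fun i h1 h2 => ?_, fun i j hij => ?_⟩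
  · unfold ncInner; split_ifs <;> omega
  · have := hh.mem_inner (i := i); have := hh.invol i
    unfold ncInner; split_ifs <;> omega
  · have := hh.ne i
    unfold ncInner; split_ifs <;> omega
  · have := hh.nc i j hij
    unfold ncInner; split_ifs <;> omega

theorem isNCPairing_ncOuter : IsNCPairing (h a + 1) (a + n + 1 - h a) (ncOuter a h) := by
  have h0 := hh.lt_first
  refine ⟨fun i hi => ?_, fun i => ?_, fun i h1 h2 => ?_, fun i j hij => ?_⟩
  · have := hh.fix i
    unfold ncOuter; split_ifs <;> omega
  · have := hh.mem_outer (i := i); have := hh.invol i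
    unfold ncOuter; split_ifs <;> omega
  · have := hh.ne i
    unfold ncOuter; split_ifs <;> omega
  · have := hh.nc i j hij
    unfold ncOuter; split_ifs <;> omega

theorem ncGlue_split : ncGlue a (h a - a - 1) (ncInner a h) (ncOuter a h) = h := by
  have h0 := hh.lt_first
  ext i
  have h1 := hh.fix i
  have h2 := hh.invol a
  have h3 : i = h a → h i = a := fun e => e ▸ h2
  have h4 : i = a → h i = h a := fun e => e ▸ rfl
  unfold ncGlue ncInner ncOuter
  split_ifs <;> omega

end Split

theorem ncWeight_ncGlue (c : ℕ → ℕ → ℝ) {a k l : ℕ} {f g : ℕ → ℕ} :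
    ncWeight c a (k + l + 2) (ncGlue a k f g) =
      c a (a + 1 + k) * ncWeight c (a + 1) k f * ncWeight c (a + k + 2) l g := by
  unfold ncWeight
  rw [Finset.prod_eq_prod_Ico_succ_bot (by omega),
    ← Finset.prod_Ico_consecutive _ (show a + 1 ≤ a + 1 + k by omega) (by omega),
    Finset.prod_eq_prod_Ico_succ_bot (show a + 1 + k < a + (k + l + 2) by omega), mul_assoc]
  have e1 : ncGlue a k f g a = a + 1 + k := by simp [ncGlue]
  have e2 : ncGlue a k f g (a + 1 + k) = a := by simp [ncGlue]
  rw [e1, e2, if_pos (by omega), if_neg (by omega), one_mul]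
  congr 2
  · refine Finset.prod_congr rfl fun i hi => ?_
    rw [Finset.mem_Ico] at hi
    rw [show ncGlue a k f g i = f i by unfold ncGlue; split_ifs <;> omega]
  · rw [show a + 1 + k + 1 = a + k + 2 by ring, show a + (k + l + 2) = a + k + 2 + l by ring]
    refine Finset.prod_congr rfl fun i hi => ?_
    rw [Finset.mem_Ico] at hi
    rw [show ncGlue a k f g i = g i by unfold ncGlue; split_ifs <;> omega]

/-- The sum over the non-crossing pairings of `{a, …, a + n - 1}`. -/
def ncSum (c : ℕ → ℕ → ℝ) (a n : ℕ) : ℝ := ∑ f ∈ ncFuns a n, ncWeight c a n f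

theorem ncSum_zero (c : ℕ → ℕ → ℝ) (a : ℕ) : ncSum c a 0 = 1 := by
  have : ncFuns a 0 = {id} := by
    ext f
    rw [mem_ncFuns, Finset.mem_singleton]
    constructor
    · intro h; ext i; exact h.fix i (by omega)
    · rintro rfl; exact ⟨fun _ _ => rfl, fun _ => rfl, fun i _ _ => by omega,
        fun i j _ _ => by simp only [id] at *; omega⟩
  simp [ncSum, this, ncWeight]

theorem ncSum_one (c : ℕ → ℕ → ℝ) (a : ℕ) : ncSum c a 1 = 0 := by
  have : ncFuns a 1 = ∅ := by
    ext f
    simp only [mem_ncFuns, Finset.notMem_empty, iff_false]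
    intro h
    have h1 := h.mem (i := a) le_rfl (by omega)
    exact h.ne a le_rfl (by omega) (by omega)
  simp [ncSum, this]

/-- The block of `a` separates the remaining points into those under it and those after it, and no
block joins the two groups. Here `p.1` counts the points under the block and `p.2` those after it.
-/
theorem ncSum_add_two (c : ℕ → ℕ → ℝ) (a n : ℕ) :
    ncSum c a (n + 2) = ∑ p ∈ Finset.HasAntidiagonal.antidiagonal n,
      c a (a + 1 + p.1) * ncSum c (a + 1) p.1 * ncSum c (a + p.1 + 2) p.2 := by
  have hR : ∀ p : ℕ × ℕ, c a (a + 1 + p.1) * ncSum c (a + 1) p.1 * ncSum c (a + p.1 + 2) p.2 =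
      ∑ q ∈ ncFuns (a + 1) p.1 ×ˢ ncFuns (a + p.1 + 2) p.2,
        c a (a + 1 + p.1) * ncWeight c (a + 1) p.1 q.1 * ncWeight c (a + p.1 + 2) p.2 q.2 := by
    intro p
    rw [Finset.sum_product, mul_assoc]
    unfold ncSum
    rw [Finset.sum_mul_sum, Finset.mul_sum]
    simp only [Finset.mul_sum, mul_assoc]
  rw [Finset.sum_congr rfl fun p _ => hR p, Finset.sum_sigma']
  unfold ncSum
  refine Finset.sum_bij'
    (fun h _ => ⟨(h a - a - 1, a + n + 1 - h a), (ncInner a h, ncOuter a h)⟩)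
    (fun q _ => ncGlue a q.1.1 q.2.1 q.2.2) ?_ ?_ ?_ ?_ ?_
  · intro h hh
    rw [mem_ncFuns] at hh
    have := hh.lt_first
    simp only [Finset.mem_sigma, Finset.mem_product, mem_ncFuns,
      Finset.HasAntidiagonal.mem_antidiagonal]
    refine ⟨by omega, isNCPairing_ncInner hh, ?_⟩
    rw [show a + (h a - a - 1) + 2 = h a + 1 by omega]
    exact isNCPairing_ncOuter hh
  · rintro ⟨⟨k, l⟩, f, g⟩ hq
    simp only [Finset.mem_sigma, Finset.mem_product, mem_ncFuns,
      Finset.HasAntidiagonal.mem_antidiagonal] at hq ⊢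
    rw [← hq.1]
    exact isNCPairing_ncGlue hq.2.1 hq.2.2
  · intro h hh
    exact ncGlue_split (mem_ncFuns.1 hh)
  · rintro ⟨⟨k, l⟩, f, g⟩ hq
    simp only [Finset.mem_sigma, Finset.mem_product, mem_ncFuns,
      Finset.HasAntidiagonal.mem_antidiagonal] at hq
    obtain ⟨hn, hf, hg⟩ := hq
    have e : ncGlue a k f g a = a + 1 + k := by simp [ncGlue]
    have e1 : ncInner a (ncGlue a k f g) = f := by
      ext i
      have := hf.fix i
      unfold ncInner; rw [e]; unfold ncGlue; split_ifs <;> omega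
    have e2 : ncOuter a (ncGlue a k f g) = g := by
      ext i
      have := hg.fix i
      unfold ncOuter; rw [e]; unfold ncGlue; split_ifs <;> omega
    simp only [e1, e2, e]
    rw [show a + 1 + k - a - 1 = k by omega, show a + n + 1 - (a + 1 + k) = l by omega]
  · intro h hh
    rw [mem_ncFuns] at hh
    have := hh.lt_first
    conv_lhs => rw [← ncGlue_split hh]
    have := ncWeight_ncGlue c (a := a) (k := h a - a - 1) (l := a + n + 1 - h a)
      (f := ncInner a h) (g := ncOuter a h)
    rw [show h a - a - 1 + (a + n + 1 - h a) + 2 = n + 2 by omega] at this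
    exact this

/-- Involutions of `Fin n` are extended to ℕ by the identity, where subintervals need no reindexing.
-/
theorem sum_ncPairings (n : ℕ) (c : Fin n → Fin n → ℝ) (d : ℕ → ℕ → ℝ)
    (hcd : ∀ i j : Fin n, d i j = c i j) :
    ∑ π ∈ ncPairings n, ∏ p ∈ Finset.univ.filter (fun p => p < π p), c p (π p) =
      ncSum d 0 n := by
  classical
  unfold ncSum
  refine Finset.sum_bij'
    (fun π _ i => if h : i < n then (π ⟨i, h⟩ : ℕ) else i)
    (fun f hf => Function.Involutive.toPerm
      (fun i : Fin n => (⟨f i, by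
        have := (mem_ncFuns.1 hf).mem (i := i) (by omega) (by omega); omega⟩ : Fin n))
      (fun i => Fin.ext ((mem_ncFuns.1 hf).invol i))) ?_ ?_ ?_ ?_ ?_
  · intro π hπ
    simp only [ncPairings, Finset.mem_filter, Finset.mem_univ, true_and] at hπ
    obtain ⟨h1, h2, h3⟩ := hπ
    rw [mem_ncFuns]
    refine ⟨fun i hi => ?_, fun i => ?_, fun i _ hi => ?_, fun i j hij => ?_⟩
    · rw [dif_neg (by omega)]
    · by_cases hi : i < n
      · simp [hi, h1]
      · simp [hi]
    · rw [zero_add] at hi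
      rw [dif_pos hi]
      intro e
      exact h2 ⟨i, hi⟩ (Fin.ext e)
    · by_cases hi : i < n
      · by_cases hj : j < n
        · simp only [hi, hj, dite_true]
          intro h4 h5
          exact h3 ⟨⟨i, hi⟩, ⟨j, hj⟩, hij, h4, h5⟩
        · have := (π ⟨i, hi⟩).2
          simp only [hi, hj, dite_true, dite_false]
          omega
      · rw [dif_neg hi]; omega
  · intro f hf
    have hf' := mem_ncFuns.1 hf
    simp only [ncPairings, Finset.mem_filter, Finset.mem_univ, true_and]
    refine ⟨fun i => Fin.ext (hf'.invol i), fun i e => ?_, ?_⟩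
    · exact hf'.ne i (by omega) (by omega) (congrArg Fin.val e)
    · rintro ⟨i, j, h1, h2, h3⟩
      exact hf'.nc i j h1 h2 h3
  · intro π hπ
    ext i
    simp
  · intro f hf
    have hf' := mem_ncFuns.1 hf
    ext i
    by_cases hi : i < n
    · simp only [hi, dite_true]
      rfl
    · simp only [hi, dite_false]
      exact (hf'.fix i (by omega)).symm
  · intro π hπ
    unfold ncWeight
    rw [zero_add, ← Finset.range_eq_Ico, Finset.prod_filter, ← Fin.prod_univ_eq_prod_range
      (fun i => if i < (if h : i < n then (π ⟨i, h⟩ : ℕ) else i) then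
        d i (if h : i < n then (π ⟨i, h⟩ : ℕ) else i) else 1)]
    refine Finset.prod_congr rfl fun i _ => ?_
    simp [hcd]

end Pairings

/-- The mixed moments of linear combinations of free semicircular variables. -/
theorem IsFockFamily.moment {ι : Type*} [DecidableEq ι] {A : Type*} [Ring A] [Algebra ℂ A]
    {φ : A →ₗ[ℂ] ℂ} {s : ι → A} (h : IsFockFamily φ s) (F : Finset ι) (n : ℕ)
    (g : Fin n → ι → ℝ) :
    φ (List.ofFn fun k => linComb F s (g k)).prod =
      ((∑ π ∈ ncPairings n, ∏ p ∈ Finset.univ.filter (fun p => p < π p),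
        ∑ i ∈ F, g p i * g (π p) i : ℝ) : ℂ) := by
  set g' : ℕ → ι → ℝ := fun k => if hk : k < n then g ⟨k, hk⟩ else 0 with hg'
  -- Vacuum coefficients and pairing sums have the same initial values and the same recursion.
  -- Subintervals start anywhere, hence the quantification over `a` and the extension of `g` by
  -- zero.
  have key : ∀ (m a : ℕ), fockWord F g' a m [] =
      (ncSum (fun k l => ∑ i ∈ F, g' k i * g' l i) a m : ℂ) := by
    intro m
    induction m using Nat.strong_induction_on with
    | _ m ih =>
      intro a
      match m with
      | 0 => simp [fockWord_zero_apply_nil, ncSum_zero]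
      | 1 => simp [fockWord_one_apply_nil, ncSum_one]
      | m + 2 =>
        rw [fockWord_add_two_apply_nil, ncSum_add_two, Complex.ofReal_sum]
        refine Finset.sum_congr rfl fun p hp => ?_
        rw [Finset.HasAntidiagonal.mem_antidiagonal] at hp
        rw [ih _ (by omega), ih _ (by omega)]
        push_cast
        ring
  rw [sum_ncPairings n (fun p q => ∑ i ∈ F, g p i * g q i)
    (fun k l => ∑ i ∈ F, g' k i * g' l i) (fun i j => by simp [hg']), ← key n 0,
    ← h.apply_fockMap, fockMap_fockWord]
  simp [hg']

/-! ### Norms and moments with respect to a faithful positive functional -/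

section Moments

/-- If the moments of `y⋆ y` with respect to a faithful positive functional grow at most like
`R ^ (2 m)`, then `‖y‖ ≤ R`. -/
theorem norm_le_of_moment_le {B : Type*} [CStarAlgebra B] (ψ : B →ₗ[ℂ] ℂ)
    (hpos : ∀ a, ∃ r : ℝ, 0 ≤ r ∧ ψ (star a * a) = r) (hfaith : ∀ a, ψ (star a * a) = 0 → a = 0)
    (y : B) {C R : ℝ} (hR : 0 ≤ R) (h : ∀ m : ℕ, (ψ ((star y * y) ^ m)).re ≤ C * (R ^ 2) ^ m) :
    ‖y‖ ≤ R := by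
  let _ := CStarAlgebra.spectralOrder B
  let _ := CStarAlgebra.spectralOrderedRing B
  by_contra! hlt
  have : Nontrivial B := ⟨y, 0, fun e => by simp [e] at hlt; linarith⟩
  set x := star y * y with hx
  have hx0 : 0 ≤ x := star_mul_self_nonneg y
  have hxn : ‖x‖ = ‖y‖ ^ 2 := by rw [hx, CStarRing.norm_star_mul_self, sq]
  obtain ⟨r, hr1, hr2⟩ := exists_between (show R ^ 2 < ‖x‖ by rw [hxn]; gcongr)
  have hr0 : 0 < r := (sq_nonneg R).trans_lt hr1
  have hsa : IsSelfAdjoint x := .of_nonneg hx0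
  have hspec : ‖x‖ ∈ spectrum ℝ x := CStarAlgebra.norm_mem_spectrum_of_nonneg hx0
  -- The cut-off lives strictly above `r`, which lies between `R ^ 2` and ‖x‖. It does not vanish at
  -- the spectral point ‖x‖, so faithfulness gives `z * z` positive mass `d`.
  set f : ℝ → ℝ := fun t => max (t - r) 0 with hf
  have hfc : Continuous f := by fun_prop
  set z := cfc f x with hz
  have hzsa : IsSelfAdjoint z := cfc_predicate f x
  have hz0 : z ≠ 0 := by
    intro e
    have h1 : f ‖x‖ ∈ spectrum ℝ z := by
      rw [hz, cfc_map_spectrum f x hsa hfc.continuousOn]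
      exact ⟨_, hspec, rfl⟩
    rw [e, spectrum.zero_eq, Set.mem_singleton_iff] at h1
    simp only [hf] at h1
    have := le_max_left (‖x‖ - r) 0
    linarith
  obtain ⟨d, hd0, hd⟩ := hpos z
  have hd1 : d ≠ 0 := fun e => hz0 (hfaith z (by rw [hd, e]; rfl))
  rw [hzsa.star_eq] at hd
  have hre : ∀ a : B, 0 ≤ a → 0 ≤ (ψ a).re := by
    intro a ha
    obtain ⟨b, rfl⟩ := CStarAlgebra.nonneg_iff_eq_star_mul_self.mp ha
    obtain ⟨t, ht, he⟩ := hpos b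
    rw [he]; exact ht
  -- Where the cut-off is nonzero, `t ^ m` is at least `r ^ m`. The moments must therefore grow at
  -- least like `d * r ^ m`, which the assumed bound forbids as `m` tends to infinity.
  have key : ∀ m : ℕ, d ≤ ‖x‖ ^ 2 * C * (R ^ 2 / r) ^ m := by
    intro m
    have h1 : 0 ≤ ‖x‖ ^ 2 • x ^ m - r ^ m • (z * z) := by
      have : ‖x‖ ^ 2 • x ^ m - r ^ m • (z * z) =
          cfc (fun t => ‖x‖ ^ 2 * t ^ m - r ^ m * (f t * f t)) x := by
        rw [cfc_sub (fun t => ‖x‖ ^ 2 * t ^ m) (fun t => r ^ m * (f t * f t)) x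
          (by fun_prop) (by fun_prop), cfc_const_mul (‖x‖ ^ 2) (fun t => t ^ m) x (by fun_prop),
          cfc_const_mul (r ^ m) (fun t => f t * f t) x (by fun_prop),
          cfc_mul f f x (by fun_prop) (by fun_prop), cfc_pow_id x m hsa]
      rw [this]
      refine cfc_nonneg fun t ht => ?_
      have ht0 : 0 ≤ t := spectrum_nonneg_of_nonneg hx0 ht
      have ht1 : t ≤ ‖x‖ := (le_abs_self t).trans (spectrum.norm_le_norm_of_mem ht)
      rcases le_total t r with htr | htr
      · have : f t = 0 := max_eq_right (by linarith)
        rw [this]; simp; positivity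
      · have e : f t = t - r := max_eq_left (by linarith)
        have h3 : f t * f t ≤ ‖x‖ ^ 2 := by rw [e, sq]; gcongr <;> linarith
        have h4 : r ^ m ≤ t ^ m := by gcongr
        have h5 : r ^ m * (f t * f t) ≤ t ^ m * ‖x‖ ^ 2 :=
          mul_le_mul h4 h3 (mul_self_nonneg _) (by positivity)
        linarith
    have h2 := hre _ h1
    rw [map_sub, LinearMap.map_smul_of_tower, LinearMap.map_smul_of_tower, hd] at h2
    simp only [Complex.sub_re, Complex.real_smul, Complex.re_ofReal_mul,
      Complex.ofReal_re] at h2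
    rw [div_pow, mul_div_assoc', le_div_iff₀ (by positivity)]
    have := mul_le_mul_of_nonneg_left (h m) (sq_nonneg ‖x‖)
    linarith
  have hlim : Filter.Tendsto (fun m : ℕ => ‖x‖ ^ 2 * C * (R ^ 2 / r) ^ m) Filter.atTop
      (nhds (‖x‖ ^ 2 * C * 0)) :=
    (tendsto_pow_atTop_nhds_zero_of_lt_one (by positivity) (by rwa [div_lt_one hr0])).const_mul _
  have := ge_of_tendsto' hlim key
  rw [mul_zero] at this
  exact hd1 (le_antisymm this hd0)

variable {A : Type*} [CStarAlgebra A] [PartialOrder A] [StarOrderedRing A] {k : ℕ}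

/-- `φ ⊗ Tr`. -/
def traceState (φ : A →ₗ[ℂ] ℂ) (k : ℕ) : CStarMatrix (Fin k) (Fin k) A →ₗ[ℂ] ℂ where
  toFun M := ∑ a, φ (M a a)
  map_add' M N := by simp [Finset.sum_add_distrib]
  map_smul' c M := by simp [Finset.mul_sum]

theorem traceState_star_mul_self (φ : A →ₗ[ℂ] ℂ) (M : CStarMatrix (Fin k) (Fin k) A) :
    traceState φ k (star M * M) = ∑ a, ∑ b, φ (star (M b a) * M b a) := by
  simp [traceState, CStarMatrix.mul_apply, CStarMatrix.star_apply]

theorem traceState_pos {φ : A →ₗ[ℂ] ℂ} (hpos : ∀ a, ∃ r : ℝ, 0 ≤ r ∧ φ (star a * a) = r)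
    (M : CStarMatrix (Fin k) (Fin k) A) :
    ∃ r : ℝ, 0 ≤ r ∧ traceState φ k (star M * M) = r := by
  choose r hr hφ using hpos
  refine ⟨∑ a, ∑ b, r (M b a), Finset.sum_nonneg fun _ _ => Finset.sum_nonneg fun _ _ => hr _, ?_⟩
  rw [traceState_star_mul_self]
  simp [hφ]

theorem traceState_faithful {φ : A →ₗ[ℂ] ℂ} (hpos : ∀ a, ∃ r : ℝ, 0 ≤ r ∧ φ (star a * a) = r)
    (hfaith : ∀ a, φ (star a * a) = 0 → a = 0)
    (M : CStarMatrix (Fin k) (Fin k) A) (hM : traceState φ k (star M * M) = 0) : M = 0 := by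
  choose r hr hφ using hpos
  rw [traceState_star_mul_self] at hM
  simp only [hφ] at hM
  rw [← Complex.ofReal_zero] at hM
  simp only [← Complex.ofReal_sum] at hM
  have h0 := Complex.ofReal_injective hM
  rw [Finset.sum_eq_zero_iff_of_nonneg
    fun _ _ => Finset.sum_nonneg fun _ _ => hr _] at h0
  ext b a
  have h1 := h0 a (Finset.mem_univ a)
  rw [Finset.sum_eq_zero_iff_of_nonneg fun _ _ => hr _] at h1
  apply hfaith
  rw [hφ, h1 b (Finset.mem_univ b)]
  rfl

variable {H : Type*} [NormedAddCommGroup H] [InnerProductSpace ℂ H] [CompleteSpace H]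

/-- The action of `M_k(A)` on `H ^ k`. -/
def matrixAction (π : A →⋆ₐ[ℂ] (H →L[ℂ] H)) (M : CStarMatrix (Fin k) (Fin k) A) :
    PiLp 2 (fun _ : Fin k => H) →L[ℂ] PiLp 2 (fun _ : Fin k => H) :=
  (PiLp.continuousLinearEquiv 2 ℂ (fun _ : Fin k => H)).symm.toContinuousLinearMap ∘L
    ContinuousLinearMap.pi fun a => ∑ b, π (M a b) ∘L PiLp.proj 2 (fun _ : Fin k => H) b

theorem matrixAction_apply (π : A →⋆ₐ[ℂ] (H →L[ℂ] H)) (M : CStarMatrix (Fin k) (Fin k) A)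
    (x : PiLp 2 (fun _ : Fin k => H)) (a : Fin k) :
    matrixAction π M x a = ∑ b, π (M a b) (x b) := by
  simp [matrixAction]

/-- The action of `M_k(A)` on `H ^ k`, as a ⋆-homomorphism. -/
def matrixActionHom (π : A →⋆ₐ[ℂ] (H →L[ℂ] H)) :
    CStarMatrix (Fin k) (Fin k) A →⋆ₙₐ[ℂ]
      (PiLp 2 (fun _ : Fin k => H) →L[ℂ] PiLp 2 (fun _ : Fin k => H)) where
  toFun := matrixAction π
  map_smul' c M := by ext x a; simp [matrixAction_apply, Finset.smul_sum]
  map_zero' := by ext x a; simp [matrixAction_apply]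
  map_add' M N := by ext x a; simp [matrixAction_apply, Finset.sum_add_distrib]
  map_mul' M N := by
    ext x a
    simp only [matrixAction_apply, CStarMatrix.mul_apply, map_sum, map_mul,
      sum_apply, mul_apply_eq_comp]
    exact Finset.sum_comm
  map_star' M := by
    rw [ContinuousLinearMap.star_eq_adjoint, ContinuousLinearMap.eq_adjoint_iff]
    intro x y
    simp only [PiLp.inner_apply, matrixAction_apply, sum_inner, inner_sum, CStarMatrix.star_apply,
      map_star, ContinuousLinearMap.star_eq_adjoint, ContinuousLinearMap.adjoint_inner_left]
    exact Finset.sum_comm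

/-- Star homomorphisms between C⋆-algebras are contractive. -/
theorem norm_matrixAction_le (π : A →⋆ₐ[ℂ] (H →L[ℂ] H)) (M : CStarMatrix (Fin k) (Fin k) A) :
    ‖matrixAction π M‖ ≤ ‖M‖ :=
  NonUnitalStarAlgHom.norm_apply_le (matrixActionHom π) M

end Moments

/-! ### Operator-valued semicircular operators on Fock space -/

section OperatorValued

theorem tsum_list {ι : Type*} (f : List ι → ENNReal) :
    ∑' w, f w = f [] + ∑' j, ∑' w, f (j :: w) := by
  classical
  rw [ENNReal.tsum_eq_add_tsum_ite [], ← ENNReal.tsum_prod (f := fun j w => f (j :: w))]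
  congr 1
  have hinj : Function.Injective (fun p : ι × List ι => p.1 :: p.2) := by
    rintro ⟨a, b⟩ ⟨c, d⟩ h
    simpa using h
  rw [← hinj.tsum_eq]
  · simp
  · intro w hw
    cases w with
    | nil => simp at hw
    | cons j w => exact ⟨(j, w), rfl⟩

variable {ι : Type*} [DecidableEq ι] {k : ℕ}

/-- The value at the word `w` of a vector of the amplified Fock space. -/
def coeffVec (v : Fin k → Fock ι) (w : List ι) : EuclideanSpace ℂ (Fin k) :=
  WithLp.toLp 2 fun a => v a w

/-- The square of the norm of a vector of the amplified Fock space. -/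
def fockNormSq (v : Fin k → Fock ι) : ENNReal := ∑' w, ENNReal.ofReal (‖coeffVec v w‖ ^ 2)

variable (F : Finset ι) (T : ι → EuclideanSpace ℂ (Fin k) →L[ℂ] EuclideanSpace ℂ (Fin k))

/-- The entries of a matrix. -/
def entry (T : EuclideanSpace ℂ (Fin k) →L[ℂ] EuclideanSpace ℂ (Fin k)) (a b : Fin k) : ℂ :=
  T (EuclideanSpace.single b 1) a

theorem apply_eq_sum_entry (T : EuclideanSpace ℂ (Fin k) →L[ℂ] EuclideanSpace ℂ (Fin k))
    (u : EuclideanSpace ℂ (Fin k)) (a : Fin k) : T u a = ∑ b, entry T a b * u b := by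
  have hu : u = ∑ b, u b • EuclideanSpace.single b (1 : ℂ) := by
    ext c
    simp [Finset.sum_apply, Pi.single_apply]
  conv_lhs => rw [hu]
  simp [entry, mul_comm]

theorem entry_adjoint (T : EuclideanSpace ℂ (Fin k) →L[ℂ] EuclideanSpace ℂ (Fin k))
    (a b : Fin k) : entry (ContinuousLinearMap.adjoint T) a b = star (entry T b a) := by
  have h := ContinuousLinearMap.adjoint_inner_right T (EuclideanSpace.single a (1 : ℂ))
    (EuclideanSpace.single b (1 : ℂ))
  rw [EuclideanSpace.inner_single_left, EuclideanSpace.inner_single_right] at h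
  simpa [entry] using h

/-- The operator `∑ (l_i + l_i⋆) ⊗ T_i`. -/
def matrixField (v : Fin k → Fock ι) : Fin k → Fock ι :=
  fun a => ∑ i ∈ F, ∑ b, entry (T i) a b • fieldOp i (v b)

theorem coeffVec_matrixField (v : Fin k → Fock ι) (w : List ι) :
    coeffVec (matrixField F T v) w =
      ∑ i ∈ F, T i (coeffVec (fun b => fieldOp i (v b)) w) := by
  ext a
  simp [coeffVec, matrixField, apply_eq_sum_entry, Finsupp.finsetSum_apply]

theorem norm_sum_apply_sq_le (u : ι → EuclideanSpace ℂ (Fin k)) :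
    ‖∑ i ∈ F, T i (u i)‖ ^ 2 ≤ (∑ i ∈ F, ‖T i‖ ^ 2) * ∑ i ∈ F, ‖u i‖ ^ 2 := by
  have h : ‖∑ i ∈ F, T i (u i)‖ ≤ ∑ i ∈ F, ‖T i‖ * ‖u i‖ :=
    (norm_sum_le _ _).trans (Finset.sum_le_sum fun i _ => (T i).le_opNorm _)
  calc ‖∑ i ∈ F, T i (u i)‖ ^ 2 ≤ (∑ i ∈ F, ‖T i‖ * ‖u i‖) ^ 2 := by gcongr
    _ ≤ _ := Finset.sum_mul_sq_le_sq_mul_sq _ _ _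

/-- The creation part `p` and the annihilation part `q` each have squared norm at most `D` times
that of `v`. For `p`, a word `j :: w` receives the single contribution of `w`; for `q`,
Cauchy-Schwarz is applied over the first letter. The factor 4 comes from ‖p + q‖² ≤ 2‖p‖² + 2‖q‖².
-/
theorem fockNormSq_matrixField_le (v : Fin k → Fock ι) :
    fockNormSq (matrixField F T v) ≤
      ENNReal.ofReal (4 * ∑ i ∈ F, ‖T i‖ ^ 2) * fockNormSq v := by
  set D := ∑ i ∈ F, ‖T i‖ ^ 2 with hD
  have hD0 : 0 ≤ D := Finset.sum_nonneg fun _ _ => sq_nonneg _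
  set N : List ι → ENNReal := fun w => ENNReal.ofReal (‖coeffVec v w‖ ^ 2) with hN
  set p : List ι → EuclideanSpace ℂ (Fin k) := fun w => match w with
    | [] => 0
    | j :: w => if j ∈ F then T j (coeffVec v w) else 0 with hp
  set q : List ι → EuclideanSpace ℂ (Fin k) :=
    fun w => ∑ i ∈ F, T i (coeffVec v (i :: w)) with hq
  have hsplit : ∀ w, coeffVec (matrixField F T v) w = p w + q w := by
    intro w
    rw [coeffVec_matrixField]
    cases w with
    | nil =>
      rw [hp, hq, zero_add]
      refine Finset.sum_congr rfl fun i _ => ?_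
      congr 1
      ext b
      simp [coeffVec, fieldOp_apply_nil]
    | cons j w =>
      have : ∀ i, coeffVec (fun b => fieldOp i (v b)) (j :: w) =
          (if i = j then coeffVec v w else 0) + coeffVec v (i :: j :: w) := by
        intro i
        ext b
        by_cases hij : i = j <;> simp [coeffVec, fieldOp_apply_cons, hij]
      simp only [this, map_add, Finset.sum_add_distrib, hp, hq]
      congr 1
      rw [Finset.sum_congr rfl fun i _ => apply_ite (T i) (i = j) (coeffVec v w) 0]
      simp
  have hbound : ∀ w, ENNReal.ofReal (‖coeffVec (matrixField F T v) w‖ ^ 2) ≤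
      2 * ENNReal.ofReal (‖p w‖ ^ 2) + 2 * ENNReal.ofReal (‖q w‖ ^ 2) := by
    intro w
    have h2 : (2 : ENNReal) = ENNReal.ofReal 2 := by simp
    have h3 : ∀ t : ℝ, 2 * ENNReal.ofReal t = ENNReal.ofReal (2 * t) := fun t => by
      rw [h2, ← ENNReal.ofReal_mul (by norm_num)]
    rw [hsplit, h3, h3, ← ENNReal.ofReal_add (by positivity) (by positivity)]
    apply ENNReal.ofReal_le_ofReal
    have := norm_add_le (p w) (q w)
    nlinarith [sq_nonneg (‖p w‖ - ‖q w‖), norm_nonneg (p w + q w)]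
  have hpsum : ∑' w, ENNReal.ofReal (‖p w‖ ^ 2) ≤ ENNReal.ofReal D * ∑' w, N w := by
    rw [tsum_list]
    simp only [hp, norm_zero]
    calc ENNReal.ofReal (0 ^ 2) +
          ∑' j, ∑' w, ENNReal.ofReal (‖if j ∈ F then T j (coeffVec v w) else 0‖ ^ 2)
        ≤ 0 + ∑' j, ∑' w, (if j ∈ F then ENNReal.ofReal (‖T j‖ ^ 2) else 0) * N w := by
          refine add_le_add (by simp) (ENNReal.tsum_le_tsum fun j => ENNReal.tsum_le_tsum fun w => ?_)
          split_ifs with hj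
          · rw [hN, ← ENNReal.ofReal_mul (by positivity), ← mul_pow]
            apply ENNReal.ofReal_le_ofReal
            gcongr
            exact (T j).le_opNorm _
          · simp
      _ = ENNReal.ofReal D * ∑' w, N w := by
          simp only [ENNReal.tsum_mul_left, ENNReal.tsum_mul_right, zero_add]
          congr 1
          rw [hD, ENNReal.ofReal_sum_of_nonneg (fun _ _ => sq_nonneg _),
            tsum_eq_sum (s := F) (fun j hj => if_neg hj)]
          exact Finset.sum_congr rfl fun j hj => if_pos hj
  have hqsum : ∑' w, ENNReal.ofReal (‖q w‖ ^ 2) ≤ ENNReal.ofReal D * ∑' w, N w := by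
    calc ∑' w, ENNReal.ofReal (‖q w‖ ^ 2)
        ≤ ∑' w, ENNReal.ofReal D * ∑' j, N (j :: w) := by
          refine ENNReal.tsum_le_tsum fun w => ?_
          calc ENNReal.ofReal (‖q w‖ ^ 2)
              ≤ ENNReal.ofReal (D * ∑ i ∈ F, ‖coeffVec v (i :: w)‖ ^ 2) :=
                ENNReal.ofReal_le_ofReal (norm_sum_apply_sq_le F T fun i => coeffVec v (i :: w))
            _ = ENNReal.ofReal D * ∑ i ∈ F, N (i :: w) := by
                rw [ENNReal.ofReal_mul hD0,
                  ENNReal.ofReal_sum_of_nonneg (f := fun i => ‖coeffVec v (i :: w)‖ ^ 2)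
                    (fun _ _ => sq_nonneg _)]
            _ ≤ _ := by gcongr; exact ENNReal.sum_le_tsum _
      _ = ENNReal.ofReal D * ∑' j, ∑' w, N (j :: w) := by
          rw [ENNReal.tsum_mul_left, ENNReal.tsum_comm]
      _ ≤ _ := by
          gcongr
          rw [tsum_list N]
          exact le_add_self
  calc fockNormSq (matrixField F T v)
      ≤ ∑' w, (2 * ENNReal.ofReal (‖p w‖ ^ 2) + 2 * ENNReal.ofReal (‖q w‖ ^ 2)) :=
        ENNReal.tsum_le_tsum hbound
    _ = 2 * ∑' w, ENNReal.ofReal (‖p w‖ ^ 2) + 2 * ∑' w, ENNReal.ofReal (‖q w‖ ^ 2) := by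
        rw [ENNReal.tsum_add, ENNReal.tsum_mul_left, ENNReal.tsum_mul_left]
    _ ≤ 2 * (ENNReal.ofReal D * ∑' w, N w) + 2 * (ENNReal.ofReal D * ∑' w, N w) := by gcongr
    _ = _ := by
        rw [ENNReal.ofReal_mul (by norm_num), ← mul_assoc, ← add_mul, ← add_mul]
        norm_num
        rfl

/-! ### The norm of operator-valued semicircular elements -/

variable {A : Type*} [CStarAlgebra A] [PartialOrder A] [StarOrderedRing A]

/-- `∑ s_i ⊗ T_i` as a matrix over `A`. -/
def matrixComb (s : ι → A) : CStarMatrix (Fin k) (Fin k) A :=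
  CStarMatrix.ofMatrix fun a b => ∑ i ∈ F, entry (T i) a b • s i

theorem matrixComb_apply (s : ι → A) (a b : Fin k) :
    matrixComb F T s a b = ∑ i ∈ F, entry (T i) a b • s i := rfl

theorem star_matrixComb {s : ι → A} (hs : ∀ i, IsSelfAdjoint (s i)) :
    star (matrixComb F T s) =
      matrixComb F (fun i => ContinuousLinearMap.adjoint (T i)) s := by
  ext a b
  simp [CStarMatrix.star_apply, matrixComb_apply, entry_adjoint, (hs _).star_eq]

theorem matrixComb_mulVec_fockMap (s : ι → A) (v : Fin k → Fock ι) (a : Fin k) :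
    ∑ b, matrixComb F T s a b * fockMap s (v b) = fockMap s (matrixField F T v a) := by
  simp only [matrixComb_apply, Finset.sum_mul, matrixField, map_sum,
    map_smul, ← mul_fockMap, smul_mul_assoc]
  exact Finset.sum_comm

/-- The columns of `(star Y * Y) ^ m` are images of iterates of the amplified field operators on the
vacuum. Their diagonal moments are vacuum coefficients, which the Fock norm bounds by `(4 * D) ^ m`.
-/
theorem norm_matrixComb_le {φ : A →ₗ[ℂ] ℂ} {s : ι → A} (h : IsFockFamily φ s)
    (hs : ∀ i, IsSelfAdjoint (s i))
    (hpos : ∀ a, ∃ r : ℝ, 0 ≤ r ∧ φ (star a * a) = r) (hfaith : ∀ a, φ (star a * a) = 0 → a = 0) :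
    ‖matrixComb F T s‖ ≤ 2 * √(∑ i ∈ F, ‖T i‖ ^ 2) := by
  set D := ∑ i ∈ F, ‖T i‖ ^ 2 with hD
  have hD0 : 0 ≤ D := Finset.sum_nonneg fun _ _ => sq_nonneg _
  set Y := matrixComb F T s with hY
  set T' := fun i => ContinuousLinearMap.adjoint (T i) with hT'
  have hDT' : ∑ i ∈ F, ‖T' i‖ ^ 2 = D := by simp [hT', hD]
  -- The unnormalised trace adds `k` diagonal entries; the constant `C := k` does not affect the
  -- resulting norm bound, which is therefore free of the matrix size.
  refine norm_le_of_moment_le (traceState φ k) (traceState_pos hpos)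
    (traceState_faithful hpos hfaith) Y (C := k) (by positivity) fun m => ?_
  have hR : (2 * √D) ^ 2 = 4 * D := by rw [mul_pow, Real.sq_sqrt hD0]; norm_num
  rw [hR]
  set G : (Fin k → Fock ι) → (Fin k → Fock ι) := fun v => matrixField F T' (matrixField F T v)
    with hG
  set e : Fin k → Fin k → Fock ι := fun a => Pi.single a (vacuum ι) with he
  have hcol : ∀ (m : ℕ) (a b : Fin k),
      ((star Y * Y) ^ m) b a = fockMap s ((G^[m] (e a)) b) := by
    intro m
    induction m with
    | zero =>
      intro a b
      by_cases hab : b = a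
      · subst hab; simp [he, fockMap_vacuum]
      · simp [he, hab]
    | succ m ih =>
      intro a b
      rw [pow_succ', mul_assoc, CStarMatrix.mul_apply, Function.iterate_succ_apply', hG,
        ← matrixComb_mulVec_fockMap, hY, star_matrixComb F T hs]
      refine Finset.sum_congr rfl fun c _ => ?_
      rw [CStarMatrix.mul_apply, ← matrixComb_mulVec_fockMap, ← hY]
      congr 1
      refine Finset.sum_congr rfl fun d _ => ?_
      rw [← ih a d, hY, star_matrixComb F T hs]
  have hnorm : ∀ (m : ℕ) (a : Fin k),
      fockNormSq (G^[m] (e a)) ≤ ENNReal.ofReal (((4 * D) ^ m) ^ 2) := by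
    intro m a
    induction m with
    | zero =>
      rw [Function.iterate_zero_apply, pow_zero, one_pow, fockNormSq, tsum_eq_single []]
      · apply ENNReal.ofReal_le_ofReal
        have : coeffVec (e a) [] = EuclideanSpace.single a (1 : ℂ) := by
          ext b
          by_cases hab : b = a
          · subst hab; simp [coeffVec, he, vacuum]
          · simp [coeffVec, he, hab]
        rw [this]; simp
      · intro w hw
        have : coeffVec (e a) w = 0 := by
          ext b
          by_cases hab : b = a
          · subst hab; simp [coeffVec, he, vacuum, hw]
          · simp [coeffVec, he, hab]
        rw [this]; simp
    | succ m ih =>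
      rw [Function.iterate_succ_apply', hG]
      calc _ ≤ ENNReal.ofReal (4 * D) * (ENNReal.ofReal (4 * D) * fockNormSq (G^[m] (e a))) := by
            refine (fockNormSq_matrixField_le F T' _).trans ?_
            rw [hDT']
            gcongr
            exact fockNormSq_matrixField_le F T _
        _ ≤ ENNReal.ofReal (4 * D) * (ENNReal.ofReal (4 * D) *
              ENNReal.ofReal (((4 * D) ^ m) ^ 2)) := by gcongr
        _ = _ := by
            rw [← ENNReal.ofReal_mul (by positivity), ← ENNReal.ofReal_mul (by positivity)]
            congr 1
            ring
  have hentry : ∀ a, (φ (((star Y * Y) ^ m) a a)).re ≤ (4 * D) ^ m := by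
    intro a
    rw [hcol, h.apply_fockMap]
    refine (Complex.re_le_norm _).trans ?_
    have h1 : ENNReal.ofReal (‖coeffVec (G^[m] (e a)) []‖ ^ 2) ≤
        ENNReal.ofReal (((4 * D) ^ m) ^ 2) := (ENNReal.le_tsum []).trans (hnorm m a)
    rw [ENNReal.ofReal_le_ofReal_iff (by positivity)] at h1
    have h2 := abs_le_of_sq_le_sq h1 (by positivity)
    exact (PiLp.norm_apply_le (coeffVec (G^[m] (e a)) []) a).trans ((le_abs_self _).trans h2)
  change (∑ a, φ (((star Y * Y) ^ m) a a)).re ≤ _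
  rw [Complex.re_sum]
  refine (Finset.sum_le_sum fun a _ => hentry a).trans ?_
  simp

end OperatorValued

/-! ### Norm estimates in the tensor product -/

section Tensor

universe u

variable {H : Type u} [NormedAddCommGroup H] [InnerProductSpace ℂ H] [CompleteSpace H]

/-- The vector `∑ x_b ⊗ e_b`. -/
def tensorSum {k : ℕ} (e : Fin k → H) (x : PiLp 2 (fun _ : Fin k => H)) : H ⊗[ℂ] H :=
  ∑ b, x b ⊗ₜ[ℂ] e b

theorem inner_tensorSum {k : ℕ} {e : Fin k → H} (he : Orthonormal ℂ e)
    (x y : PiLp 2 (fun _ : Fin k => H)) :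
    ⟪tensorSum e x, tensorSum e y⟫_ℂ = ⟪x, y⟫_ℂ := by
  classical
  rw [orthonormal_iff_ite] at he
  simp [tensorSum, sum_inner, inner_sum, he, PiLp.inner_apply]

theorem norm_tensorSum {k : ℕ} {e : Fin k → H} (he : Orthonormal ℂ e)
    (x : PiLp 2 (fun _ : Fin k => H)) : ‖tensorSum e x‖ = ‖x‖ := by
  rw [@norm_eq_sqrt_re_inner ℂ, @norm_eq_sqrt_re_inner ℂ _ _ _ _ x, inner_tensorSum he]

/-- Finitely many algebraic tensors have their second legs in a common finite-dimensional subspace;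
`V` is the isometry given by an orthonormal basis of it. -/
theorem exists_tensorSum (S : Set (H ⊗[ℂ] H)) (hS : S.Finite) :
    ∃ (k : ℕ) (V : EuclideanSpace ℂ (Fin k) →L[ℂ] H), ‖V‖ ≤ 1 ∧
      Orthonormal ℂ (fun b => V (EuclideanSpace.single b 1)) ∧
      ∀ z ∈ S, ∃ x, z = tensorSum (fun b => V (EuclideanSpace.single b 1)) x := by
  obtain ⟨N, hN, hSN⟩ := TensorProduct.exists_finite_submodule_right_of_setFinite S hS
  have : FiniteDimensional ℂ N := hN
  set o := stdOrthonormalBasis ℂ N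
  set V : EuclideanSpace ℂ (Fin (Module.finrank ℂ N)) →ₗᵢ[ℂ] H :=
    N.subtypeₗᵢ.comp o.repr.symm.toLinearIsometry with hV
  have hVo : ∀ b, V (EuclideanSpace.single b 1) = o b := by
    intro b
    simp [hV, -OrthonormalBasis.repr_symm_single, ← OrthonormalBasis.repr_symm_single]
  refine ⟨_, V.toContinuousLinearMap, V.norm_toContinuousLinearMap_le, ?_, ?_⟩
  · have := o.orthonormal.comp_linearIsometry N.subtypeₗᵢ
    convert this using 2 with b
    exact hVo b
  · suffices hex : ∀ t, ∃ x, LinearMap.lTensor H N.subtype t =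
        tensorSum (fun b => V.toContinuousLinearMap (EuclideanSpace.single b 1)) x by
      intro z hz
      obtain ⟨t, rfl⟩ := hSN hz
      exact hex t
    intro t
    induction t using TensorProduct.induction_on with
    | zero => exact ⟨0, by simp [tensorSum]⟩
    | tmul h n =>
      refine ⟨WithLp.toLp 2 fun b => o.repr n b • h, ?_⟩
      simp only [LinearMap.lTensor_tmul, tensorSum, TensorProduct.smul_tmul,
        ← TensorProduct.tmul_sum]
      congr 1
      conv_lhs => rw [← o.sum_repr n]
      simp only [map_sum, map_smul]
      exact Finset.sum_congr rfl fun b _ => congrArg _ (hVo b).symm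
    | add t t' ht ht' =>
      obtain ⟨x, hx⟩ := ht
      obtain ⟨x', hx'⟩ := ht'
      refine ⟨x + x', ?_⟩
      rw [map_add, hx, hx']
      simp [tensorSum, TensorProduct.add_tmul, Finset.sum_add_distrib]

variable {ι : Type*} [DecidableEq ι] {A : Type*} [CStarAlgebra A] [PartialOrder A]
  [StarOrderedRing A]

/-- The two vectors see each `b i` only through its compression to a finite-dimensional subspace.
The compressions are matrices of no larger norm, so the matrix estimate applies, with a bound
independent of the dimension. -/
theorem norm_inner_mapL_le (π : A →⋆ₐ[ℂ] (H →L[ℂ] H)) {φ : A →ₗ[ℂ] ℂ} {s : ι → A}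
    (h : IsFockFamily φ s) (hs : ∀ i, IsSelfAdjoint (s i))
    (hpos : ∀ a, ∃ r : ℝ, 0 ≤ r ∧ φ (star a * a) = r) (hfaith : ∀ a, φ (star a * a) = 0 → a = 0)
    (F : Finset ι) (b : ι → H →L[ℂ] H) (z w : H ⊗[ℂ] H) :
    ‖⟪w, ∑ i ∈ F, TensorProduct.mapL (π (s i)) (b i) z⟫_ℂ‖ ≤
      2 * √(∑ i ∈ F, ‖b i‖ ^ 2) * ‖w‖ * ‖z‖ := by
  obtain ⟨k, V, hV, he, hex⟩ := exists_tensorSum {z, w} (by simp)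
  obtain ⟨x, rfl⟩ := hex z (by simp)
  obtain ⟨y, rfl⟩ := hex w (by simp)
  set T : ι → EuclideanSpace ℂ (Fin k) →L[ℂ] EuclideanSpace ℂ (Fin k) :=
    fun i => ContinuousLinearMap.adjoint V ∘L b i ∘L V with hT
  have hTn : ∀ i, ‖T i‖ ≤ ‖b i‖ := by
    intro i
    calc ‖T i‖ ≤ ‖ContinuousLinearMap.adjoint V‖ * (‖b i‖ * ‖V‖) :=
          (ContinuousLinearMap.opNorm_comp_le _ _).trans
            (by gcongr; exact ContinuousLinearMap.opNorm_comp_le _ _)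
      _ ≤ 1 * (‖b i‖ * 1) := by
          rw [LinearIsometryEquiv.norm_map]
          gcongr
      _ = ‖b i‖ := by ring
  have hentry : ∀ i a c, entry (T i) a c =
      ⟪V (EuclideanSpace.single a 1), b i (V (EuclideanSpace.single c 1))⟫_ℂ := by
    intro i a c
    rw [← ContinuousLinearMap.adjoint_inner_right, EuclideanSpace.inner_single_left]
    simp [entry, hT]
  have key : ⟪tensorSum (fun b => V (EuclideanSpace.single b 1)) y,
      ∑ i ∈ F, TensorProduct.mapL (π (s i)) (b i)
        (tensorSum (fun b => V (EuclideanSpace.single b 1)) x)⟫_ℂ =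
      ⟪y, matrixAction π (matrixComb F T s) x⟫_ℂ := by
    simp only [tensorSum, map_sum, TensorProduct.mapL_tmul, sum_inner, inner_sum,
      TensorProduct.inner_tmul, PiLp.inner_apply, matrixAction_apply, matrixComb_apply, hentry,
      sum_apply, map_smul, smul_apply, inner_smul_right]
    rw [Finset.sum_congr rfl fun l _ => Finset.sum_comm, Finset.sum_comm]
    refine Finset.sum_congr rfl fun i _ => ?_
    rw [Finset.sum_comm]
    exact Finset.sum_congr rfl fun j _ => Finset.sum_congr rfl fun l _ => mul_comm _ _
  rw [key, norm_tensorSum he, norm_tensorSum he]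
  have h1 : ‖matrixAction π (matrixComb F T s) x‖ ≤ 2 * √(∑ i ∈ F, ‖b i‖ ^ 2) * ‖x‖ := by
    refine ((matrixAction π (matrixComb F T s)).le_opNorm x).trans ?_
    gcongr
    refine (norm_matrixAction_le π _).trans
      ((norm_matrixComb_le F T h hs hpos hfaith).trans ?_)
    gcongr with i
    exact hTn i
  calc _ ≤ ‖y‖ * ‖matrixAction π (matrixComb F T s) x‖ := norm_inner_le_norm _ _
    _ ≤ ‖y‖ * (2 * √(∑ i ∈ F, ‖b i‖ ^ 2) * ‖x‖) := by gcongr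
    _ = _ := by ring

theorem norm_sum_tensorOp_le (π : A →⋆ₐ[ℂ] (H →L[ℂ] H)) {φ : A →ₗ[ℂ] ℂ} {s : ι → A}
    (h : IsFockFamily φ s) (hs : ∀ i, IsSelfAdjoint (s i))
    (hpos : ∀ a, ∃ r : ℝ, 0 ≤ r ∧ φ (star a * a) = r) (hfaith : ∀ a, φ (star a * a) = 0 → a = 0)
    (F : Finset ι) (b : ι → H →L[ℂ] H) :
    ‖∑ i ∈ F, tensorOp (π (s i)) (b i)‖ ≤ 2 * √(∑ i ∈ F, ‖b i‖ ^ 2) := by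
  refine ContinuousLinearMap.opNorm_le_bound _ (by positivity) fun v => ?_
  induction v using UniformSpace.Completion.induction_on with
  | hp => exact isClosed_le (by fun_prop) (by fun_prop)
  | ih z =>
    have e : (∑ i ∈ F, tensorOp (π (s i)) (b i)) (z : HilbertTensor H) =
        ((∑ i ∈ F, TensorProduct.mapL (π (s i)) (b i) z : H ⊗[ℂ] H) : HilbertTensor H) := by
      rw [sum_apply]
      simp only [tensorOp, ContinuousLinearMap.completion_apply_coe]
      exact (map_sum (UniformSpace.Completion.toComplL (𝕜 := ℂ) (E := H ⊗[ℂ] H)) _ _).symm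
    rw [e, UniformSpace.Completion.norm_coe, UniformSpace.Completion.norm_coe]
    -- Testing against the image itself turns the bound on the sesquilinear form into a bound on the
    -- norm.
    set w := ∑ i ∈ F, TensorProduct.mapL (π (s i)) (b i) z with hw
    have h1 := norm_inner_mapL_le π h hs hpos hfaith F b z w
    rw [← hw, inner_self_eq_norm_sq_to_K (𝕜 := ℂ) w, norm_pow, RCLike.norm_ofReal, abs_norm] at h1
    rcases eq_or_lt_of_le (norm_nonneg w) with h0 | h0
    · rw [← h0]; positivity
    · nlinarith

theorem norm_linComb_le {φ : A →ₗ[ℂ] ℂ} {s : ι → A}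
    (h : IsFockFamily φ s) (hs : ∀ i, IsSelfAdjoint (s i))
    (hpos : ∀ a, ∃ r : ℝ, 0 ≤ r ∧ φ (star a * a) = r) (hfaith : ∀ a, φ (star a * a) = 0 → a = 0)
    (F : Finset ι) (g : ι → ℝ) :
    ‖linComb F s g‖ ≤ 2 * √(∑ i ∈ F, g i ^ 2) := by
  set T : ι → EuclideanSpace ℂ (Fin 1) →L[ℂ] EuclideanSpace ℂ (Fin 1) :=
    fun i => (g i : ℂ) • ContinuousLinearMap.id ℂ _ with hT
  have e : linComb F s g = matrixComb F T s 0 0 := by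
    simp [linComb, matrixComb_apply, entry, hT]
  rw [e]
  refine (CStarMatrix.norm_entry_le_norm).trans
    ((norm_matrixComb_le F T h hs hpos hfaith).trans_eq ?_)
  simp [hT, norm_smul]

end Tensor

/-! ### Free semicircular families -/

section Semicircle

open Polynomial

theorem integral_semicircleLaw (f : ℝ → ℝ) :
    ∫ t, f t ∂(semicircleLaw 2) =
      ∫ t in (-2 : ℝ)..2, 2 / (Real.pi * 2 ^ 2) * √(2 ^ 2 - t ^ 2) * f t := by
  have hm : Measurable fun t : ℝ => ENNReal.ofReal
      ((Set.Icc (-2 : ℝ) 2).indicator (fun t => 2 / (Real.pi * 2 ^ 2) * √(2 ^ 2 - t ^ 2)) t) := by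
    refine ENNReal.measurable_ofReal.comp (Measurable.indicator ?_ measurableSet_Icc)
    fun_prop
  rw [semicircleLaw, integral_withDensity_eq_integral_toReal_smul hm
    (Filter.Eventually.of_forall fun t => ENNReal.ofReal_lt_top),
    intervalIntegral.integral_of_le (by norm_num), ← MeasureTheory.integral_Icc_eq_integral_Ioc,
    ← MeasureTheory.integral_indicator measurableSet_Icc]
  congr 1
  ext t
  by_cases ht : t ∈ Set.Icc (-2 : ℝ) 2
  · rw [Set.indicator_of_mem ht, Set.indicator_of_mem ht, ENNReal.toReal_ofReal (by positivity),
      smul_eq_mul]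
  · simp [Set.indicator_of_notMem ht]

/-- Under t = 2 cos θ the weight and the Jacobian give a multiple of sin² θ, and S_k(2 cos θ) sin θ
= sin((k+1)θ). What remains is a difference of cosines of the nonzero frequencies k and k + 2 on [0,
π]. -/
theorem integral_chebyshev_semicircleLaw {k : ℕ} (hk : 1 ≤ k) :
    ∫ t, (Chebyshev.S ℝ k).eval t ∂(semicircleLaw 2) = 0 := by
  rw [integral_semicircleLaw]
  simp only [mul_assoc, intervalIntegral.integral_const_mul]
  refine mul_eq_zero_of_right _ ?_
  set g : ℝ → ℝ := fun t => √(2 ^ 2 - t ^ 2) * (Chebyshev.S ℝ k).eval t with hg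
  have hgc : Continuous g := by fun_prop
  have h1 := intervalIntegral.integral_comp_mul_deriv (a := 0) (b := Real.pi)
    (f := fun θ => 2 * Real.cos θ) (f' := fun θ => 2 * -Real.sin θ) (g := g)
    (fun θ _ => (Real.hasDerivAt_cos θ).const_mul 2) (by fun_prop) hgc
  simp only [Real.cos_zero, Real.cos_pi] at h1
  rw [show (2 : ℝ) * 1 = 2 by norm_num, show (2 : ℝ) * -1 = -2 by norm_num,
    intervalIntegral.integral_symm (-2) 2] at h1
  rw [← neg_eq_zero, ← h1]
  have h2 : ∀ θ ∈ Set.uIcc 0 Real.pi, (g ∘ fun θ => 2 * Real.cos θ) θ * (2 * -Real.sin θ) =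
      2 * Real.cos (((k + 2 : ℕ) : ℝ) * θ) - 2 * Real.cos ((k : ℝ) * θ) := by
    intro θ hθ
    rw [Set.uIcc_of_le Real.pi_pos.le] at hθ
    have hs := Real.sin_nonneg_of_mem_Icc hθ
    have h3 : √(2 ^ 2 - (2 * Real.cos θ) ^ 2) = 2 * Real.sin θ := by
      rw [show (2 : ℝ) ^ 2 - (2 * Real.cos θ) ^ 2 = (2 * Real.sin θ) ^ 2 by
        rw [mul_pow, mul_pow, Real.sin_sq]; ring]
      exact Real.sqrt_sq (by positivity)
    have h4 := Chebyshev.S_two_mul_real_cos θ k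
    push_cast at h4 ⊢
    have h5 : Real.cos ((k + 2) * θ) =
        Real.cos ((k + 1) * θ) * Real.cos θ - Real.sin ((k + 1) * θ) * Real.sin θ := by
      rw [← Real.cos_add]; ring_nf
    have h6 : Real.cos (k * θ) =
        Real.cos ((k + 1) * θ) * Real.cos θ + Real.sin ((k + 1) * θ) * Real.sin θ := by
      rw [← Real.cos_sub]; ring_nf
    simp only [Function.comp, hg]
    rw [h3, h5, h6, ← h4]
    ring
  have h7 : ∀ m : ℕ, 1 ≤ m → ∫ θ in (0 : ℝ)..Real.pi, 2 * Real.cos ((m : ℝ) * θ) = 0 := by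
    intro m hm
    have : (m : ℝ) ≠ 0 := by positivity
    rw [intervalIntegral.integral_const_mul, intervalIntegral.integral_comp_mul_left _ this,
      integral_cos]
    simp
  rw [intervalIntegral.integral_congr h2, intervalIntegral.integral_sub
    (by apply Continuous.intervalIntegrable; fun_prop)
    (by apply Continuous.intervalIntegrable; fun_prop), h7 _ (by omega), h7 _ hk, sub_zero]

theorem integrable_pow_semicircleLaw (n : ℕ) :
    MeasureTheory.Integrable (fun t : ℝ => t ^ n) (semicircleLaw 2) := by
  have hm : Measurable fun t : ℝ => ENNReal.ofReal
      ((Set.Icc (-2 : ℝ) 2).indicator (fun t => 2 / (Real.pi * 2 ^ 2) * √(2 ^ 2 - t ^ 2)) t) := by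
    refine ENNReal.measurable_ofReal.comp (Measurable.indicator ?_ measurableSet_Icc)
    fun_prop
  rw [semicircleLaw, MeasureTheory.integrable_withDensity_iff_integrable_smul' hm
    (Filter.Eventually.of_forall fun t => ENNReal.ofReal_lt_top)]
  have hc : MeasureTheory.IntegrableOn
      (fun t : ℝ => 2 / (Real.pi * 2 ^ 2) * √(2 ^ 2 - t ^ 2) * t ^ n) (Set.Icc (-2) 2) :=
    Continuous.integrableOn_Icc (by fun_prop)
  rw [← MeasureTheory.integrable_indicator_iff measurableSet_Icc] at hc
  refine hc.congr (Filter.Eventually.of_forall fun t => ?_)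
  by_cases ht : t ∈ Set.Icc (-2 : ℝ) 2
  · rw [Set.indicator_of_mem ht]
    simp only [Set.indicator_of_mem ht]
    rw [ENNReal.toReal_ofReal (by positivity), smul_eq_mul]
  · simp [Set.indicator_of_notMem ht]

end Semicircle

/-! ### Words as alternating products of Chebyshev polynomials -/

section Runs

open Polynomial

variable {ι : Type*} [DecidableEq ι] {A : Type*} [Ring A] [Algebra ℂ A]

theorem wordPoly_cons_of_head?_ne (s : ι → A) (i : ι) (w : List ι) (hw : w.head? ≠ some i) :
    wordPoly s (i :: w) = s i * wordPoly s w := by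
  cases w with
  | nil => simp [wordPoly]
  | cons j w =>
    have : i ≠ j := fun e => hw (by simp [e])
    simp [wordPoly, this]

/-- Within a run, the recursion of `wordPoly` is the three-term recurrence of the Chebyshev
polynomials. The condition on the head of `w` ensures that nothing is subtracted at the end of the
run. -/
theorem wordPoly_replicate_append (s : ι → A) (i : ι) (w : List ι) (hw : w.head? ≠ some i) :
    ∀ k : ℕ, wordPoly s (List.replicate k i ++ w) =
      aeval (s i) (Chebyshev.S ℂ k) * wordPoly s w
  | 0 => by simp
  | 1 => by simp [wordPoly_cons_of_head?_ne s i w hw]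
  | k + 2 => by
    have e : wordPoly s (List.replicate (k + 2) i ++ w) =
        s i * wordPoly s (List.replicate (k + 1) i ++ w) -
          wordPoly s (List.replicate k i ++ w) := by
      simp [List.replicate_succ, wordPoly]
    rw [e, wordPoly_replicate_append s i w hw (k + 1), wordPoly_replicate_append s i w hw k]
    push_cast
    rw [Chebyshev.S_add_two]
    simp [sub_mul, mul_assoc]

theorem exists_replicate_append (i : ι) (w : List ι) :
    ∃ (k : ℕ) (w' : List ι), w = List.replicate k i ++ w' ∧ w'.head? ≠ some i := by
  induction w with
  | nil => exact ⟨0, [], rfl, by simp⟩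
  | cons j w ih =>
    by_cases hij : j = i
    · obtain ⟨k, w', h1, h2⟩ := ih
      exact ⟨k + 1, w', by rw [h1, hij]; rfl, h2⟩
    · exact ⟨0, j :: w, rfl, by simpa using hij⟩

/-- The polynomial attached to a word is an alternating product of Chebyshev polynomials. -/
theorem exists_alternating (s : ι → A) (w : List ι) :
    ∃ ℓ : List (ι × A), (ℓ.map Prod.snd).prod = wordPoly s w ∧
      ℓ.IsChain (fun p q => p.1 ≠ q.1) ∧
      (∀ p ∈ ℓ, ∃ k : ℕ, 1 ≤ k ∧ p.2 = aeval (s p.1) (Chebyshev.S ℂ k)) ∧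
      ℓ.head?.map Prod.fst = w.head? := by
  -- The leading run is split off whole. The clause on heads is carried along so that the next
  -- factor is known to belong to a different index.
  induction hn : w.length using Nat.strong_induction_on generalizing w with
  | _ n ih =>
    cases w with
    | nil => exact ⟨[], by simp [wordPoly], by simp, by simp, rfl⟩
    | cons i w =>
      obtain ⟨k, w', h1, h2⟩ := exists_replicate_append i w
      obtain ⟨ℓ, l1, l2, l3, l4⟩ := ih w'.length
        (by rw [← hn, h1]; simp) w' rfl
      have e : i :: w = List.replicate (k + 1) i ++ w' := by rw [h1]; rfl
      refine ⟨(i, aeval (s i) (Chebyshev.S ℂ (k + 1 : ℕ))) :: ℓ, ?_, ?_, ?_, by simp⟩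
      · rw [e, wordPoly_replicate_append s i w' h2, List.map_cons, List.prod_cons, l1]
      · rw [List.isChain_cons]
        refine ⟨fun q hq hiq => h2 ?_, l2⟩
        rw [← l4, Option.mem_def.1 hq]
        exact congrArg some hiq.symm
      · intro p hp
        rcases List.mem_cons.1 hp with rfl | hp
        · exact ⟨k + 1, by omega, rfl⟩
        · exact l3 p hp

end Runs

/-! ### From freeness to the Fock space description -/

section FreeFamily

open Polynomial

universe u

variable {H : Type u} [NormedAddCommGroup H] [InnerProductSpace ℂ H] [CompleteSpace H]

/-- A von Neumann algebra is a centralizer, hence norm-closed; this makes it a C⋆-algebra in its own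
right. -/
instance isClosed_vonNeumannAlgebra (S : VonNeumannAlgebra H) :
    IsClosed (S.toStarSubalgebra : Set (H →L[ℂ] H)) := by
  have h := S.centralizer_centralizer
  change IsClosed (S : Set (H →L[ℂ] H))
  rw [← h]
  exact Set.isClosed_centralizer _

theorem aeval_mem_vonNeumannClosure (𝒜 : NCProbSpace H) (a : 𝒜.Var) (p : ℂ[X]) :
    ((aeval a p : 𝒜.Var) : H →L[ℂ] H) ∈ vonNeumannClosure {(a : H →L[ℂ] H)} := by
  set B := (vonNeumannClosure {(a : H →L[ℂ] H)}).toStarSubalgebra with hB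
  have ha : (a : H →L[ℂ] H) ∈ B := subset_vonNeumannClosure _ rfl
  change ((aeval a p : 𝒜.Var) : H →L[ℂ] H) ∈ B
  clear_value B
  induction p using Polynomial.induction_on' with
  | add p q hp hq => rw [map_add]; exact B.add_mem hp hq
  | monomial n c =>
    rw [aeval_monomial, ← Algebra.smul_def]
    exact B.smul_mem (B.pow_mem ha n) c

theorem NCProbSpace.IsStandardSemicircular.state_chebyshev {𝒜 : NCProbSpace H} {a : 𝒜.Var}
    (ha : 𝒜.IsStandardSemicircular a) {k : ℕ} (hk : 1 ≤ k) :
    𝒜.state (aeval a (Chebyshev.S ℂ k)) = 0 := by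
  have e : Chebyshev.S ℂ k = (Chebyshev.S ℝ k).map (algebraMap ℝ ℂ) := by simp
  have h1 : 𝒜.state (aeval a (Chebyshev.S ℂ k)) =
      ((∫ t, (Chebyshev.S ℝ k).eval t ∂(semicircleLaw 2) : ℝ) : ℂ) := by
    simp only [eval_eq_sum_range]
    rw [MeasureTheory.integral_finsetSum _
      fun n _ => (integrable_pow_semicircleLaw n).const_mul _, aeval_eq_sum_range, e,
      natDegree_map]
    simp only [map_sum, map_smul, MeasureTheory.integral_const_mul, ha.2.2, coeff_map]
    push_cast
    rfl
  rw [h1, integral_chebyshev_semicircleLaw hk, Complex.ofReal_zero]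

theorem NCProbSpace.Free.isFockFamily {ι : Type*} [DecidableEq ι] {𝒜 : NCProbSpace H}
    {s : ι → 𝒜.Var} (hfree : 𝒜.Free s) (hs : ∀ i, 𝒜.IsStandardSemicircular (s i)) :
    IsFockFamily 𝒜.state s := by
  intro w
  split_ifs with hw
  · rw [hw, wordPoly, 𝒜.state_one]
  · obtain ⟨ℓ, h1, h2, h3, h4⟩ := exists_alternating s w
    rw [← h1]
    refine hfree ℓ ?_ h2 ?_
    · rintro rfl
      cases w <;> simp_all
    · intro p hp
      obtain ⟨k, hk, e⟩ := h3 p hp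
      rw [e]
      exact ⟨aeval_mem_vonNeumannClosure 𝒜 _ _, (hs p.1).state_chebyshev hk⟩

end FreeFamily

/-! ### The coefficients of Lévy's series -/

section Levy

open Real

/-- The coefficients of Lévy's series. -/
def levyCoeff (t : ℝ) : ℕ+ ⊕ ℕ+ → ℝ
  | .inl n => (cos (n * t) - 1) / (n * √π)
  | .inr n => sin (n * t) / (n * √π)

/-- The derivatives of the coefficients. -/
def levyDeriv (t : ℝ) : ℕ+ ⊕ ℕ+ → ℝ
  | .inl n => -sin (n * t) / √π
  | .inr n => cos (n * t) / √π

theorem continuous_levyCoeff (i : ℕ+ ⊕ ℕ+) : Continuous fun t => levyCoeff t i := by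
  cases i <;> simp only [levyCoeff] <;> fun_prop

theorem continuous_levyDeriv (i : ℕ+ ⊕ ℕ+) : Continuous fun t => levyDeriv t i := by
  cases i <;> simp only [levyDeriv] <;> fun_prop

theorem hasDerivAt_levyCoeff (i : ℕ+ ⊕ ℕ+) (t : ℝ) :
    HasDerivAt (fun t => levyCoeff t i) (levyDeriv t i) t := by
  have hπ : √π ≠ 0 := by positivity
  cases i with
  | inl n =>
    have hn : (n : ℝ) ≠ 0 := by positivity
    simp only [levyCoeff, levyDeriv]
    convert! (((hasDerivAt_id t).const_mul (n : ℝ)).cos.sub_const 1).div_const (n * √π) using 1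
    simp only [id]
    field_simp
  | inr n =>
    have hn : (n : ℝ) ≠ 0 := by positivity
    simp only [levyCoeff, levyDeriv]
    convert! ((hasDerivAt_id t).const_mul (n : ℝ)).sin.div_const (n * √π) using 1
    simp only [id]
    field_simp

theorem integral_levyDeriv (i : ℕ+ ⊕ ℕ+) (a b : ℝ) :
    ∫ u in a..b, levyDeriv u i = levyCoeff b i - levyCoeff a i :=
  intervalIntegral.integral_eq_sub_of_hasDerivAt (fun u _ => hasDerivAt_levyCoeff i u)
    ((continuous_levyDeriv i).intervalIntegrable _ _)

/-- This is the Fourier series of the second Bernoulli polynomial, rescaled to period 2π. -/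
theorem hasSum_cos_div_sq {x : ℝ} (hx : x ∈ Set.Icc 0 (2 * π)) :
    HasSum (fun n : ℕ+ => cos (n * x) / (n : ℝ) ^ 2) (π ^ 2 / 6 - π * x / 2 + x ^ 2 / 4) := by
  have h := hasSum_one_div_nat_pow_mul_cos one_ne_zero (x := x / (2 * π))
    ⟨by have := hx.1; positivity, by rw [div_le_one (by positivity)]; exact hx.2⟩
  rw [← PNat.coe_injective.hasSum_iff] at h
  · convert h using 1
    · ext n
      simp only [Function.comp]
      rw [show 2 * π * (n : ℝ) * (x / (2 * π)) = n * x by field_simp]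
      ring
    · have : (Polynomial.map (algebraMap ℚ ℝ) (Polynomial.bernoulli (2 * 1))).eval (x / (2 * π)) =
          (x / (2 * π)) ^ 2 - x / (2 * π) + 1 / 6 := by
        simp [Polynomial.bernoulli, Finset.sum_range_succ, bernoulli_two, bernoulli_one]
        ring
      rw [this]
      simp
      field_simp
      ring
  · intro n hn
    have : n = 0 := by
      by_contra h0
      exact hn ⟨⟨n, Nat.pos_of_ne_zero h0⟩, rfl⟩
    simp [this]

/-- Each numerator is cos n(s-t) - cos ns - cos nt + 1, so the cosine series is used at |s - t|, s,
t and 0. -/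
theorem hasSum_levyCoeff_mul {s t : ℝ} (hs : s ∈ Set.Icc 0 (2 * π)) (ht : t ∈ Set.Icc 0 (2 * π)) :
    HasSum (fun n : ℕ+ => levyCoeff s (.inl n) * levyCoeff t (.inl n) +
      levyCoeff s (.inr n) * levyCoeff t (.inr n)) (min s t - s * t / (2 * π)) := by
  have hd : |s - t| ∈ Set.Icc 0 (2 * π) :=
    ⟨abs_nonneg _, abs_le.2 ⟨by linarith [hs.1, ht.2], by linarith [hs.2, ht.1]⟩⟩
  have h0 := hasSum_cos_div_sq (x := 0) ⟨le_rfl, by positivity⟩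
  have h := ((((hasSum_cos_div_sq hd).sub (hasSum_cos_div_sq hs)).sub
    (hasSum_cos_div_sq ht)).add h0).div_const π
  have e : min s t - s * t / (2 * π) = (π ^ 2 / 6 - π * |s - t| / 2 + |s - t| ^ 2 / 4 -
      (π ^ 2 / 6 - π * s / 2 + s ^ 2 / 4) - (π ^ 2 / 6 - π * t / 2 + t ^ 2 / 4) +
        (π ^ 2 / 6 - π * 0 / 2 + 0 ^ 2 / 4)) / π := by
    rcases le_total s t with hst | hst
    · rw [min_eq_left hst, abs_of_nonpos (by linarith)]
      field_simp
      ring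
    · rw [min_eq_right hst, abs_of_nonneg (by linarith)]
      field_simp
      ring
  rw [e]
  convert! h using 2 with n
  have hn : (n : ℝ) ≠ 0 := by positivity
  have hπ : √π ^ 2 = π := sq_sqrt pi_pos.le
  have hc : cos (n * |s - t|) = cos (n * s) * cos (n * t) + sin (n * s) * sin (n * t) := by
    rw [← cos_sub, ← mul_sub]
    rcases abs_choice (s - t) with e | e <;> rw [e]
    rw [mul_neg, cos_neg]
  simp only [levyCoeff]
  rw [hc, mul_zero, cos_zero, div_mul_div_comm, div_mul_div_comm, ← add_div,
    show (n : ℝ) * √π * (n * √π) = n ^ 2 * √π ^ 2 by ring, hπ]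
  field_simp
  ring

/-- The full series is the variance of a bridge increment, |s - t| - (s - t)²/(2π). -/
theorem sum_levyCoeff_sub_sq_le {s t : ℝ} (hs : s ∈ Set.Icc 0 (2 * π))
    (ht : t ∈ Set.Icc 0 (2 * π)) (F : Finset ℕ+) :
    ∑ i ∈ F.disjSum F, (levyCoeff s i - levyCoeff t i) ^ 2 ≤ |s - t| := by
  have h := ((hasSum_levyCoeff_mul hs hs).sub ((hasSum_levyCoeff_mul hs ht).mul_left 2)).add
    (hasSum_levyCoeff_mul ht ht)
  have h1 := sum_le_hasSum F (fun n _ => ?_) h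
  · rw [Finset.sum_disjSum, ← Finset.sum_add_distrib]
    refine (Finset.sum_le_sum fun n _ => le_of_eq ?_).trans (h1.trans ?_)
    · ring
    · have h2 : 0 ≤ (s - t) ^ 2 / (2 * π) := by positivity
      have h3 : (s - t) ^ 2 / (2 * π) =
          s * s / (2 * π) - 2 * (s * t / (2 * π)) + t * t / (2 * π) := by ring
      rw [min_self, min_self]
      rcases le_total s t with hst | hst
      · rw [min_eq_left hst, abs_of_nonpos (by linarith)]; linarith
      · rw [min_eq_right hst, abs_of_nonneg (by linarith)]; linarith
  · have : 0 ≤ (levyCoeff s (.inl n) - levyCoeff t (.inl n)) ^ 2 +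
      (levyCoeff s (.inr n) - levyCoeff t (.inr n)) ^ 2 := by positivity
    linarith

/-! ### Orthogonality -/

theorem integral_cos_int_mul (m : ℤ) :
    ∫ u in (0 : ℝ)..2 * π, cos (m * u) = if m = 0 then 2 * π else 0 := by
  split_ifs with hm
  · simp [hm]
  · have : (m : ℝ) ≠ 0 := by exact_mod_cast hm
    rw [intervalIntegral.integral_comp_mul_left _ this, integral_cos,
      show (m : ℝ) * (2 * π) = ((2 * m : ℤ) : ℝ) * π by push_cast; ring, sin_int_mul_pi]
    simp

theorem integral_sin_int_mul (m : ℤ) : ∫ u in (0 : ℝ)..2 * π, sin (m * u) = 0 := by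
  by_cases hm : m = 0
  · simp [hm]
  · have : (m : ℝ) ≠ 0 := by exact_mod_cast hm
    rw [intervalIntegral.integral_comp_mul_left _ this, integral_sin, cos_int_mul_two_pi]
    simp

theorem integral_levyDeriv_mul (i j : ℕ+ ⊕ ℕ+) :
    ∫ u in (0 : ℝ)..2 * π, levyDeriv u i * levyDeriv u j = if i = j then 1 else 0 := by
  have hπ : √π * √π = π := mul_self_sqrt pi_pos.le
  have hc : ∀ m : ℤ, IntervalIntegrable (fun u => cos (m * u)) MeasureTheory.volume 0 (2 * π) :=
    fun m => Continuous.intervalIntegrable (by fun_prop) _ _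
  have hs : ∀ m : ℤ, IntervalIntegrable (fun u => sin (m * u)) MeasureTheory.volume 0 (2 * π) :=
    fun m => Continuous.intervalIntegrable (by fun_prop) _ _
  -- Sum frequencies never vanish, so only the difference frequency can contribute, and only when n
  -- = m.
  have hadd : ∀ n m : ℕ+, ((n : ℤ) + m : ℤ) ≠ 0 := fun n m => by positivity
  have hsub : ∀ n m : ℕ+, ((n : ℤ) - m : ℤ) = 0 ↔ n = m := fun n m => by
    rw [sub_eq_zero]; exact_mod_cast Iff.rfl
  have e1 : ∀ (n m : ℕ+) (u : ℝ), cos (((n : ℤ) - m : ℤ) * u) =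
      cos (n * u) * cos (m * u) + sin (n * u) * sin (m * u) := fun n m u => by
    rw [← cos_sub]; push_cast; ring_nf
  have e2 : ∀ (n m : ℕ+) (u : ℝ), cos (((n : ℤ) + m : ℤ) * u) =
      cos (n * u) * cos (m * u) - sin (n * u) * sin (m * u) := fun n m u => by
    rw [← cos_add]; push_cast; ring_nf
  have e3 : ∀ (n m : ℕ+) (u : ℝ), sin (((n : ℤ) - m : ℤ) * u) =
      sin (n * u) * cos (m * u) - cos (n * u) * sin (m * u) := fun n m u => by
    rw [← sin_sub]; push_cast; ring_nf
  have e4 : ∀ (n m : ℕ+) (u : ℝ), sin (((n : ℤ) + m : ℤ) * u) =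
      sin (n * u) * cos (m * u) + cos (n * u) * sin (m * u) := fun n m u => by
    rw [← sin_add]; push_cast; ring_nf
  have hcase : ∀ (x y : ℝ), x / √π * (y / √π) = x * y / π := fun x y => by
    rw [div_mul_div_comm, hπ]
  have hfin : ∀ n m : ℕ+, ((if n = m then 2 * π else 0) : ℝ) / (2 * π) = if n = m then 1 else 0 := by
    intro n m
    split_ifs
    · field_simp
    · simp
  rcases i with n | n <;> rcases j with m | m <;> simp only [levyDeriv, hcase]
  · rw [intervalIntegral.integral_congr (g := fun u =>
      (cos (((n : ℤ) - m : ℤ) * u) - cos (((n : ℤ) + m : ℤ) * u)) / (2 * π))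
      fun u _ => by simp only [e1, e2]; field_simp; ring]
    rw [intervalIntegral.integral_div, intervalIntegral.integral_sub (hc _) (hc _),
      integral_cos_int_mul, integral_cos_int_mul, if_neg (hadd n m), sub_zero]
    simp only [hsub, hfin, Sum.inl.injEq]
  · rw [intervalIntegral.integral_congr (g := fun u =>
      (-sin (((n : ℤ) - m : ℤ) * u) - sin (((n : ℤ) + m : ℤ) * u)) / (2 * π))
      fun u _ => by simp only [e3, e4]; field_simp; ring]
    rw [intervalIntegral.integral_div, intervalIntegral.integral_sub (f := fun u => -sin (((n : ℤ) - m : ℤ) * u)) (hs _).neg (hs _),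
      intervalIntegral.integral_neg, integral_sin_int_mul, integral_sin_int_mul]
    simp
  · rw [intervalIntegral.integral_congr (g := fun u =>
      (sin (((n : ℤ) - m : ℤ) * u) - sin (((n : ℤ) + m : ℤ) * u)) / (2 * π))
      fun u _ => by simp only [e3, e4]; field_simp; ring]
    rw [intervalIntegral.integral_div, intervalIntegral.integral_sub (hs _) (hs _),
      integral_sin_int_mul, integral_sin_int_mul]
    simp
  · rw [intervalIntegral.integral_congr (g := fun u =>
      (cos (((n : ℤ) - m : ℤ) * u) + cos (((n : ℤ) + m : ℤ) * u)) / (2 * π))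
      fun u _ => by simp only [e1, e2]; field_simp; ring]
    rw [intervalIntegral.integral_div, intervalIntegral.integral_add (hc _) (hc _),
      integral_cos_int_mul, integral_cos_int_mul, if_neg (hadd n m), add_zero]
    simp only [hsub, hfin, Sum.inr.injEq]

/-- The coefficients `∫ f_i df_j` of the Lévy area. -/
def levyArea : ℕ+ ⊕ ℕ+ → ℕ+ ⊕ ℕ+ → ℝ
  | .inl n, .inr m => if n = m then 1 / n else 0
  | .inr n, .inl m => if n = m then -(1 / n) else 0
  | _, _ => 0

/-- Up to a constant, each coefficient is ±1/n times the derivative of its partner. The constant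
integrates to zero against a derivative, since the coefficients agree at 0 and 2π; orthonormality
does the rest. -/
theorem integral_levyCoeff_mul_levyDeriv (i j : ℕ+ ⊕ ℕ+) :
    ∫ u in (0 : ℝ)..2 * π, levyCoeff u i * levyDeriv u j = levyArea i j := by
  have h0 : ∫ u in (0 : ℝ)..2 * π, levyDeriv u j = 0 := by
    rw [integral_levyDeriv]
    cases j with
    | inl n =>
      have : cos (n * (2 * π)) = 1 := cos_nat_mul_two_pi n
      simp [levyCoeff, this]
    | inr n =>
      have : sin (n * (2 * π)) = 0 := by
        rw [show (n : ℝ) * (2 * π) = ((2 * n : ℕ) : ℝ) * π by push_cast; ring, sin_nat_mul_pi]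
      simp [levyCoeff, this]
  have hint : ∀ i', IntervalIntegrable (fun u => levyDeriv u i' * levyDeriv u j)
      MeasureTheory.volume 0 (2 * π) := fun i' =>
    ((continuous_levyDeriv i').mul (continuous_levyDeriv j)).intervalIntegrable _ _
  have hj : IntervalIntegrable (fun u => levyDeriv u j) MeasureTheory.volume 0 (2 * π) :=
    (continuous_levyDeriv j).intervalIntegrable _ _
  cases i with
  | inl n =>
    have hn : (n : ℝ) ≠ 0 := by positivity
    have e : ∀ u, levyCoeff u (.inl n) * levyDeriv u j =
        1 / n * (levyDeriv u (.inr n) * levyDeriv u j) - 1 / (n * √π) * levyDeriv u j := by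
      intro u; simp only [levyCoeff, levyDeriv]; field_simp
    simp only [e]
    rw [intervalIntegral.integral_sub ((hint _).const_mul _) (hj.const_mul _),
      intervalIntegral.integral_const_mul, intervalIntegral.integral_const_mul, h0,
      integral_levyDeriv_mul]
    cases j <;> simp [levyArea]
  | inr n =>
    have hn : (n : ℝ) ≠ 0 := by positivity
    have e : ∀ u, levyCoeff u (.inr n) * levyDeriv u j =
        -(1 / n) * (levyDeriv u (.inl n) * levyDeriv u j) := by
      intro u; simp only [levyCoeff, levyDeriv]; field_simp
    simp only [e]
    rw [intervalIntegral.integral_const_mul, integral_levyDeriv_mul]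
    cases j <;> simp [levyArea]

/-! ### Bessel's inequality over a partition -/

/-- The function equal to `g k` on the k-th interval may jump at the nodes, so the usual expansion
of the squared distance to the projection is done interval by interval and then summed. -/
theorem sum_sq_integral_le {ι : Type*} [DecidableEq ι] (J : Finset ι) (e : ℝ → ι → ℝ)
    (he : ∀ i, Continuous fun u => e u i) {a b : ℝ}
    (horth : ∀ i j, ∫ u in a..b, e u i * e u j = if i = j then 1 else 0)
    (n : ℕ) (τ : ℕ → ℝ) (hτ : Monotone τ) (h0 : τ 0 = a) (hn : τ n = b)
    (g : ℕ → ℝ → ℝ) (hg : ∀ k, Continuous (g k)) :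
    ∑ j ∈ J, (∑ k ∈ Finset.range n, ∫ u in τ k..τ (k + 1), g k u * e u j) ^ 2 ≤
      ∑ k ∈ Finset.range n, ∫ u in τ k..τ (k + 1), g k u ^ 2 := by
  set K : ι → ℝ := fun j => ∑ k ∈ Finset.range n, ∫ u in τ k..τ (k + 1), g k u * e u j with hK
  have hexp : ∀ k, ∫ u in τ k..τ (k + 1), (g k u - ∑ j ∈ J, K j * e u j) ^ 2 =
      (∫ u in τ k..τ (k + 1), g k u ^ 2) -
        2 * ∑ j ∈ J, K j * (∫ u in τ k..τ (k + 1), g k u * e u j) +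
        ∑ i ∈ J, ∑ j ∈ J, K i * K j * ∫ u in τ k..τ (k + 1), e u i * e u j := by
    intro k
    have e1 : ∀ u, (g k u - ∑ j ∈ J, K j * e u j) ^ 2 =
        g k u ^ 2 - 2 * ∑ j ∈ J, K j * (g k u * e u j) +
          ∑ i ∈ J, ∑ j ∈ J, K i * K j * (e u i * e u j) := by
      intro u
      have e2 : ∑ i ∈ J, ∑ j ∈ J, K i * K j * (e u i * e u j) = (∑ j ∈ J, K j * e u j) ^ 2 := by
        rw [sq, Finset.sum_mul_sum]
        exact Finset.sum_congr rfl fun i _ => Finset.sum_congr rfl fun j _ => by ring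
      have e3 : ∑ j ∈ J, K j * (g k u * e u j) = g k u * ∑ j ∈ J, K j * e u j := by
        rw [Finset.mul_sum]
        exact Finset.sum_congr rfl fun i _ => by ring
      rw [e2, e3]; ring
    simp only [e1]
    rw [intervalIntegral.integral_add, intervalIntegral.integral_sub,
      intervalIntegral.integral_const_mul, intervalIntegral.integral_finsetSum,
      intervalIntegral.integral_finsetSum]
    · congr 1
      · simp only [intervalIntegral.integral_const_mul]
      · refine Finset.sum_congr rfl fun i _ => ?_
        rw [intervalIntegral.integral_finsetSum]
        · simp only [intervalIntegral.integral_const_mul]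
        · exact fun j _ => Continuous.intervalIntegrable (by fun_prop) _ _
    all_goals intros; apply Continuous.intervalIntegrable; fun_prop
  have hnn : 0 ≤ ∑ k ∈ Finset.range n,
      ∫ u in τ k..τ (k + 1), (g k u - ∑ j ∈ J, K j * e u j) ^ 2 :=
    Finset.sum_nonneg fun k _ =>
      intervalIntegral.integral_nonneg (hτ (Nat.le_succ k)) fun u _ => sq_nonneg _
  simp only [hexp, Finset.sum_add_distrib, Finset.sum_sub_distrib] at hnn
  have h2 : ∑ k ∈ Finset.range n, 2 * ∑ j ∈ J, K j * (∫ u in τ k..τ (k + 1), g k u * e u j) =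
      2 * ∑ j ∈ J, K j ^ 2 := by
    rw [← Finset.mul_sum, Finset.sum_comm]
    congr 1
    refine Finset.sum_congr rfl fun j _ => ?_
    rw [← Finset.mul_sum, sq]
  have h3 : ∑ k ∈ Finset.range n, ∑ i ∈ J, ∑ j ∈ J,
      K i * K j * (∫ u in τ k..τ (k + 1), e u i * e u j) = ∑ j ∈ J, K j ^ 2 := by
    rw [Finset.sum_comm]
    refine Finset.sum_congr rfl fun i hi => ?_
    rw [Finset.sum_comm]
    have : ∀ j, ∑ k ∈ Finset.range n, K i * K j * (∫ u in τ k..τ (k + 1), e u i * e u j) =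
        if i = j then K i * K j else 0 := by
      intro j
      rw [← Finset.mul_sum, intervalIntegral.sum_integral_adjacent_intervals
        fun k _ => Continuous.intervalIntegrable (by fun_prop) _ _, h0, hn, horth]
      simp
    simp only [this]
    rw [Finset.sum_ite_eq, if_pos hi, sq]
  rw [h2, h3] at hnn
  linarith

/-- The Hilbert-Schmidt distance of the coefficients of the Riemann sums to those of the Lévy
area. -/
theorem sum_levyArea_sub_sq_le (F : Finset ℕ+) (n : ℕ) (τ : ℕ → ℝ) (hτ : Monotone τ)
    (h0 : τ 0 = 0) (hn : τ n = 2 * π) {δ : ℝ} (hδ : ∀ k < n, τ (k + 1) - τ k < δ) :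
    ∑ i ∈ F.disjSum F, ∑ j ∈ F.disjSum F,
      (∑ k ∈ Finset.range n, levyCoeff (τ k) i * (levyCoeff (τ (k + 1)) j - levyCoeff (τ k) j) -
        levyArea i j) ^ 2 ≤ 2 * π * δ := by
  have hmem : ∀ k ≤ n, τ k ∈ Set.Icc 0 (2 * π) := fun k hk =>
    ⟨h0 ▸ hτ (Nat.zero_le k), hn ▸ hτ hk⟩
  -- Both the increment of the j-th coefficient and the area are integrals against the j-th
  -- derivative; squaring absorbs the sign of their difference.
  have hK : ∀ i j, (∑ k ∈ Finset.range n,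
      levyCoeff (τ k) i * (levyCoeff (τ (k + 1)) j - levyCoeff (τ k) j) - levyArea i j) ^ 2 =
      (∑ k ∈ Finset.range n, ∫ u in τ k..τ (k + 1),
        (levyCoeff u i - levyCoeff (τ k) i) * levyDeriv u j) ^ 2 := by
    intro i j
    have hc := fun i => continuous_levyCoeff i
    have hd := fun i => continuous_levyDeriv i
    rw [← integral_levyCoeff_mul_levyDeriv, ← h0, ← hn,
      ← intervalIntegral.sum_integral_adjacent_intervals (f := fun u => levyCoeff u i * levyDeriv u j)
        fun k _ => ((hc i).mul (hd j)).intervalIntegrable _ _, ← Finset.sum_sub_distrib,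
      ← neg_sq, ← Finset.sum_neg_distrib]
    congr 1
    refine Finset.sum_congr rfl fun k _ => ?_
    rw [← integral_levyDeriv, ← intervalIntegral.integral_const_mul,
      ← intervalIntegral.integral_sub (g := fun u => levyCoeff u i * levyDeriv u j) (((hd j).const_mul _).intervalIntegrable _ _)
        (((hc i).mul (hd j)).intervalIntegrable _ _), ← intervalIntegral.integral_neg]
    congr 1
    ext u
    ring
  simp only [hK]
  have hc := fun i => continuous_levyCoeff i
  calc _ ≤ ∑ i ∈ F.disjSum F, ∑ k ∈ Finset.range n, ∫ u in τ k..τ (k + 1),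
        (levyCoeff u i - levyCoeff (τ k) i) ^ 2 :=
        Finset.sum_le_sum fun i _ => sum_sq_integral_le (F.disjSum F) levyDeriv
          continuous_levyDeriv integral_levyDeriv_mul n τ hτ h0 hn
          (fun k u => levyCoeff u i - levyCoeff (τ k) i) fun k => (hc i).sub continuous_const
    _ = ∑ k ∈ Finset.range n, ∫ u in τ k..τ (k + 1), ∑ i ∈ F.disjSum F,
        (levyCoeff u i - levyCoeff (τ k) i) ^ 2 := by
        rw [Finset.sum_comm]
        refine Finset.sum_congr rfl fun k _ => ?_
        rw [intervalIntegral.integral_finsetSum]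
        exact fun i _ => (((hc i).sub continuous_const).pow 2).intervalIntegrable _ _
    _ ≤ ∑ k ∈ Finset.range n, ∫ u in τ k..τ (k + 1), δ := by
        refine Finset.sum_le_sum fun k hk => ?_
        rw [Finset.mem_range] at hk
        refine intervalIntegral.integral_mono_on (hτ (Nat.le_succ k)) ?_ (by simp) fun u hu => ?_
        · exact (continuous_finsetSum _ fun i _ =>
            ((hc i).sub continuous_const).pow 2).intervalIntegrable _ _
        · have h1 := hmem k hk.le
          have h2 := hmem (k + 1) hk
          refine (sum_levyCoeff_sub_sq_le ⟨h1.1.trans hu.1, hu.2.trans h2.2⟩ h1 F).trans ?_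
          rw [abs_of_nonneg (by linarith [hu.1])]
          linarith [hδ k hk, hu.2]
    _ = 2 * π * δ := by
        simp only [intervalIntegral.integral_const, smul_eq_mul]
        rw [← Finset.sum_mul, Finset.sum_range_sub, h0, hn, sub_zero]

end Levy

/-! ### Convergence of semicircular series -/

section Assembly

universe u

variable {H : Type u} [NormedAddCommGroup H] [InnerProductSpace ℂ H] [CompleteSpace H]

theorem norm_tensorOp_le (a b : H →L[ℂ] H) : ‖tensorOp a b‖ ≤ ‖a‖ * ‖b‖ := by
  refine ContinuousLinearMap.opNorm_le_bound _ (by positivity) fun v => ?_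
  induction v using UniformSpace.Completion.induction_on with
  | hp => exact isClosed_le (by fun_prop) (by fun_prop)
  | ih z =>
    rw [tensorOp, ContinuousLinearMap.completion_apply_coe, UniformSpace.Completion.norm_coe,
      UniformSpace.Completion.norm_coe]
    exact ((TensorProduct.mapL a b).le_opNorm z).trans
      (by gcongr; exact TensorProduct.norm_mapL_le a b)

theorem tensorOp_ext {X Y : HilbertTensor H →L[ℂ] HilbertTensor H}
    (h : ∀ z : H ⊗[ℂ] H, X z = Y z) : X = Y := by
  ext v
  induction v using UniformSpace.Completion.induction_on with
  | hp => exact isClosed_eq (by fun_prop) (by fun_prop)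
  | ih z => exact h z

theorem tensorOp_add_left (a a' b : H →L[ℂ] H) :
    tensorOp (a + a') b = tensorOp a b + tensorOp a' b := tensorOp_ext fun z => by
  simp only [tensorOp, TensorProduct.mapL_add_left, add_apply,
    ContinuousLinearMap.completion_apply_coe]
  exact UniformSpace.Completion.coe_add _ _

theorem tensorOp_add_right (a b b' : H →L[ℂ] H) :
    tensorOp a (b + b') = tensorOp a b + tensorOp a b' := tensorOp_ext fun z => by
  simp only [tensorOp, TensorProduct.mapL_add_right, add_apply,
    ContinuousLinearMap.completion_apply_coe]
  exact UniformSpace.Completion.coe_add _ _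

theorem tensorOp_smul_left (c : ℂ) (a b : H →L[ℂ] H) :
    tensorOp (c • a) b = c • tensorOp a b := tensorOp_ext fun z => by
  simp only [tensorOp, TensorProduct.mapL_smul_left, smul_apply,
    ContinuousLinearMap.completion_apply_coe]
  exact UniformSpace.Completion.coe_smul _ _

theorem tensorOp_smul_right (c : ℂ) (a b : H →L[ℂ] H) :
    tensorOp a (c • b) = c • tensorOp a b := tensorOp_ext fun z => by
  simp only [tensorOp, TensorProduct.mapL_smul_right, smul_apply,
    ContinuousLinearMap.completion_apply_coe]
  exact UniformSpace.Completion.coe_smul _ _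

/-- The bilinear map `(a, b) ↦ a ⊗ b`. -/
def tensorOpₗ : (H →L[ℂ] H) →ₗ[ℂ] (H →L[ℂ] H) →ₗ[ℂ] (HilbertTensor H →L[ℂ] HilbertTensor H) :=
  LinearMap.mk₂ ℂ tensorOp tensorOp_add_left tensorOp_smul_left tensorOp_add_right
    tensorOp_smul_right

theorem tensorOpₗ_apply (a b : H →L[ℂ] H) : tensorOpₗ a b = tensorOp a b := rfl

theorem isBoundedBilinearMap_tensorOp :
    IsBoundedBilinearMap ℂ fun p : (H →L[ℂ] H) × (H →L[ℂ] H) => tensorOp p.1 p.2 where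
  add_left := tensorOp_add_left
  smul_left := tensorOp_smul_left
  add_right := tensorOp_add_right
  smul_right := tensorOp_smul_right
  bound := ⟨1, one_pos, fun a b => (norm_tensorOp_le a b).trans_eq (by rw [one_mul])⟩

theorem continuous_tensorOp :
    Continuous fun p : (H →L[ℂ] H) × (H →L[ℂ] H) => tensorOp p.1 p.2 :=
  isBoundedBilinearMap_tensorOp.continuous

namespace NCProbSpace

variable (𝒜 : NCProbSpace H)

/-- The inclusion of the algebra into the bounded operators. -/
def incl : 𝒜.Var →⋆ₐ[ℂ] (H →L[ℂ] H) := 𝒜.alg.toStarSubalgebra.subtype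

-- Positive functionals on a C⋆-algebra are automatically continuous, so moments pass to norm
-- limits.
open scoped ComplexOrder in
theorem continuous_state : Continuous 𝒜.state := by
  let _ := CStarAlgebra.spectralOrder 𝒜.Var
  have _ := CStarAlgebra.spectralOrderedRing 𝒜.Var
  let f : 𝒜.Var →ₚ[ℂ] ℂ := PositiveLinearMap.mk₀ 𝒜.state fun x hx => by
    obtain ⟨b, rfl⟩ := CStarAlgebra.nonneg_iff_eq_star_mul_self.mp hx
    obtain ⟨r, hr, e⟩ := 𝒜.state_nonneg b
    rw [e]
    exact_mod_cast hr
  exact map_continuous f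

theorem continuous_tmul : Continuous fun p : 𝒜.Var × 𝒜.Var => 𝒜.tmul p.1 p.2 := by
  have h1 : Continuous fun p : 𝒜.Var × 𝒜.Var => ((p.1 : H →L[ℂ] H), (p.2 : H →L[ℂ] H)) := by
    fun_prop
  have h2 := continuous_tensorOp.comp h1
  exact h2.subtype_mk _

/-- The bilinear map `(a, b) ↦ a ⊗ b` into the tensor product of the algebra with itself. -/
def tmulₗ : 𝒜.Var →ₗ[ℂ] 𝒜.Var →ₗ[ℂ] 𝒜.TensorVar :=
  LinearMap.mk₂ ℂ 𝒜.tmul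
    (fun _ _ _ => Subtype.ext (tensorOp_add_left _ _ _))
    (fun _ _ _ => Subtype.ext (tensorOp_smul_left _ _ _))
    (fun _ _ _ => Subtype.ext (tensorOp_add_right _ _ _))
    (fun _ _ _ => Subtype.ext (tensorOp_smul_right _ _ _))

theorem tmulₗ_apply (a b : 𝒜.Var) : 𝒜.tmulₗ a b = 𝒜.tmul a b := rfl

variable {𝒜} {ι : Type*} [DecidableEq ι] {s : ι → 𝒜.Var}

theorem norm_linComb_le (h𝒜 : 𝒜.IsFaithful) (h : IsFockFamily 𝒜.state s)
    (hs : ∀ i, IsSelfAdjoint (s i)) (F : Finset ι) (g : ι → ℝ) :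
    ‖linComb F s g‖ ≤ 2 * √(∑ i ∈ F, g i ^ 2) :=
  let _ := CStarAlgebra.spectralOrder 𝒜.Var
  have _ := CStarAlgebra.spectralOrderedRing 𝒜.Var
  FreeBridge.norm_linComb_le h hs 𝒜.state_nonneg h𝒜 F g

theorem tmul_linComb (F : Finset ι) (g g' : ι → ℝ) :
    𝒜.tmul (linComb F s g) (linComb F s g') =
      ∑ i ∈ F, ∑ j ∈ F, ((g i * g' j : ℝ) : ℂ) • 𝒜.tmul (s i) (s j) := by
  simp only [← tmulₗ_apply, linComb, map_sum, map_smul, LinearMap.sum_apply, LinearMap.smul_apply,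
    Complex.ofReal_mul, mul_smul, Finset.smul_sum]
  rw [Finset.sum_comm]
  exact Finset.sum_congr rfl fun i _ => Finset.sum_congr rfl fun j _ => smul_comm _ _ _

/-- The operator-valued bound is applied to the first leg with the row combinations as coefficients,
and the scalar bound to each row; each costs a factor 2. -/
theorem norm_sum_tensorOp_le (h𝒜 : 𝒜.IsFaithful) (h : IsFockFamily 𝒜.state s)
    (hs : ∀ i, IsSelfAdjoint (s i)) (F : Finset ι) (M : ι → ι → ℝ) :
    ‖∑ i ∈ F, ∑ j ∈ F, (M i j : ℂ) • 𝒜.tmul (s i) (s j)‖ ≤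
      4 * √(∑ i ∈ F, ∑ j ∈ F, M i j ^ 2) := by
  let _ := CStarAlgebra.spectralOrder 𝒜.Var
  have _ := CStarAlgebra.spectralOrderedRing 𝒜.Var
  have e : ((∑ i ∈ F, ∑ j ∈ F, (M i j : ℂ) • 𝒜.tmul (s i) (s j) : 𝒜.TensorVar) :
      HilbertTensor H →L[ℂ] HilbertTensor H) =
      ∑ i ∈ F, tensorOp (𝒜.incl (s i)) (𝒜.incl (linComb F s (M i))) := by
    simp only [linComb, map_sum, map_smul, ← tensorOpₗ_apply]
    push_cast
    rfl
  change ‖((∑ i ∈ F, ∑ j ∈ F, (M i j : ℂ) • 𝒜.tmul (s i) (s j) : 𝒜.TensorVar) :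
      HilbertTensor H →L[ℂ] HilbertTensor H)‖ ≤ _
  rw [e]
  refine (FreeBridge.norm_sum_tensorOp_le 𝒜.incl h hs 𝒜.state_nonneg h𝒜 F _).trans ?_
  have h2 : ∑ i ∈ F, ‖𝒜.incl (linComb F s (M i))‖ ^ 2 ≤ 2 ^ 2 * ∑ i ∈ F, ∑ j ∈ F, M i j ^ 2 := by
    rw [Finset.mul_sum]
    refine Finset.sum_le_sum fun i _ => ?_
    have h3 : ‖𝒜.incl (linComb F s (M i))‖ ≤ 2 * √(∑ j ∈ F, M i j ^ 2) :=
      norm_linComb_le h𝒜 h hs F (M i)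
    calc _ ≤ (2 * √(∑ j ∈ F, M i j ^ 2)) ^ 2 := by gcongr
      _ = _ := by rw [mul_pow, Real.sq_sqrt (Finset.sum_nonneg fun _ _ => sq_nonneg _)]
  calc _ ≤ 2 * √(2 ^ 2 * ∑ i ∈ F, ∑ j ∈ F, M i j ^ 2) := by gcongr
    _ = _ := by rw [Real.sqrt_mul (by norm_num), Real.sqrt_sq (by norm_num)]; ring

/-- A series whose partial sums are bounded by the `ℓ²` norms of its coefficients converges. -/
theorem summable_of_norm_sum_le {κ E : Type*} [NormedAddCommGroup E] [CompleteSpace E]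
    {f : κ → E} {g : κ → ℝ} (hg : Summable g) {C : ℝ}
    (h : ∀ F : Finset κ, ‖∑ i ∈ F, f i‖ ≤ C * √(∑ i ∈ F, g i)) : Summable f := by
  have hC : ∀ F : Finset κ, ‖∑ i ∈ F, f i‖ ≤ |C| * √(∑ i ∈ F, g i) := fun F =>
    (h F).trans (by gcongr; exact le_abs_self C)
  rw [summable_iff_vanishing_norm] at hg ⊢
  intro ε hε
  -- Adding 1 covers the case C = 0.
  obtain ⟨S, hS⟩ := hg ((ε / (|C| + 1)) ^ 2) (by positivity)
  refine ⟨S, fun F hF => (hC F).trans_lt ?_⟩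
  have h1 := (le_abs_self _).trans_lt (hS F hF)
  have h2 : √(∑ i ∈ F, g i) < ε / (|C| + 1) := by
    rw [Real.sqrt_lt' (by positivity)]
    exact h1
  have h3 : (|C| + 1) * √(∑ i ∈ F, g i) < ε := by
    rwa [lt_div_iff₀ (by positivity), mul_comm] at h2
  nlinarith [Real.sqrt_nonneg (∑ i ∈ F, g i)]

theorem summable_smul (h𝒜 : 𝒜.IsFaithful) (h : IsFockFamily 𝒜.state s)
    (hs : ∀ i, IsSelfAdjoint (s i)) {g : ι → ℝ} (hg : Summable fun i => g i ^ 2) :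
    Summable fun i => (g i : ℂ) • s i :=
  summable_of_norm_sum_le hg fun F => norm_linComb_le h𝒜 h hs F g

end NCProbSpace

end Assembly

section Assembly

universe u

variable {H : Type u} [NormedAddCommGroup H] [InnerProductSpace ℂ H] [CompleteSpace H]

/-! ### The Lévy representation of the free Brownian bridge -/

section Bridge

variable {𝒜 : NCProbSpace H} {ξ η : ℕ+ → 𝒜.Var}

theorem summable_one_div_sq : Summable fun n : ℕ+ => 1 / (n : ℝ) ^ 2 := by
  have h := hasSum_cos_div_sq (x := 0) ⟨le_rfl, by positivity⟩
  simpa using h.summable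

theorem summable_levyCoeff_sq {t : ℝ} (ht : t ∈ Set.Icc 0 (2 * Real.pi)) :
    Summable fun i => levyCoeff t i ^ 2 := by
  have h := (hasSum_levyCoeff_mul ht ht).summable
  have h1 : Summable fun n : ℕ+ => levyCoeff t (.inl n) ^ 2 :=
    h.of_nonneg_of_le (fun _ => sq_nonneg _) fun n => by nlinarith [sq_nonneg (levyCoeff t (.inr n))]
  have h2 : Summable fun n : ℕ+ => levyCoeff t (.inr n) ^ 2 :=
    h.of_nonneg_of_le (fun _ => sq_nonneg _) fun n => by nlinarith [sq_nonneg (levyCoeff t (.inl n))]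
  exact Summable.sum _ h1 h2

variable (h𝒜 : 𝒜.IsFaithful) (h : IsFockFamily 𝒜.state (Sum.elim ξ η))
  (hs : ∀ i, IsSelfAdjoint (Sum.elim ξ η i))
include h𝒜 h hs

theorem summable_levyTerms {t : ℝ} (ht : t ∈ Set.Icc 0 (2 * Real.pi)) :
    Summable (𝒜.levyCosTerm ξ t) ∧ Summable (𝒜.levySinTerm η t) := by
  have h1 := 𝒜.summable_smul h𝒜 h hs (summable_levyCoeff_sq ht)
  have h2 := h1.comp_injective Sum.inl_injective
  have h3 := h1.comp_injective Sum.inr_injective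
  exact ⟨h2.congr fun n => rfl, h3.congr fun n => rfl⟩

theorem tendsto_levyBridge {t : ℝ} (ht : t ∈ Set.Icc 0 (2 * Real.pi)) :
    Filter.Tendsto (fun F : Finset ℕ+ => linComb (F.disjSum F) (Sum.elim ξ η) (levyCoeff t))
      Filter.atTop (nhds (𝒜.levyBridge ξ η t)) := by
  obtain ⟨h1, h2⟩ := summable_levyTerms h𝒜 h hs ht
  refine (h1.hasSum.add h2.hasSum).congr fun F => ?_
  rw [linComb, Finset.sum_disjSum, Finset.sum_add_distrib]
  rfl

theorem isSelfAdjoint_levyBridge {t : ℝ} (ht : t ∈ Set.Icc 0 (2 * Real.pi)) :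
    IsSelfAdjoint (𝒜.levyBridge ξ η t) := by
  refine (isClosed_eq continuous_star continuous_id).mem_of_tendsto
    (tendsto_levyBridge h𝒜 h hs ht) (Filter.Eventually.of_forall fun F => ?_)
  refine isSelfAdjoint_sum _ fun i _ => ?_
  exact IsSelfAdjoint.smul (by simp [IsSelfAdjoint]) (hs i)

theorem isFreeBrownianBridge_levyBridge :
    𝒜.IsFreeBrownianBridge (2 * Real.pi) (𝒜.levyBridge ξ η) := by
  refine ⟨fun t => isSelfAdjoint_levyBridge h𝒜 h hs t.2, fun n j => ?_⟩
  have hL : Filter.Tendsto (fun F : Finset ℕ+ => 𝒜.state (List.ofFn fun k =>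
      linComb (F.disjSum F) (Sum.elim ξ η) (levyCoeff (j k))).prod) Filter.atTop
      (nhds (𝒜.state (List.ofFn fun k => 𝒜.levyBridge ξ η (j k)).prod)) := by
    refine (𝒜.continuous_state.tendsto _).comp ?_
    have hc : Continuous fun v : Fin n → 𝒜.Var => (List.ofFn v).prod := by
      simp only [List.ofFn_eq_map]
      exact continuous_list_prod _ fun k _ => continuous_apply k
    exact (hc.tendsto _).comp (tendsto_pi_nhds.2 fun k => tendsto_levyBridge h𝒜 h hs (j k).2)
  refine tendsto_nhds_unique hL ?_
  simp only [h.moment]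
  refine (Complex.continuous_ofReal.tendsto _).comp
    (tendsto_finsetSum _ fun π _ => tendsto_finsetProd _ fun p _ => ?_)
  refine (hasSum_levyCoeff_mul (j p).2 (j (π p)).2).congr fun F => ?_
  rw [Finset.sum_disjSum, Finset.sum_add_distrib]

theorem sum_levyArea_smul (F : Finset ℕ+) :
    ∑ i ∈ F.disjSum F, ∑ j ∈ F.disjSum F,
      (levyArea i j : ℂ) • 𝒜.tmul (Sum.elim ξ η i) (Sum.elim ξ η j) =
      ∑ n ∈ F, (1 / (n : ℂ)) • (𝒜.tmul (ξ n) (η n) - 𝒜.tmul (η n) (ξ n)) := by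
  simp only [Finset.sum_disjSum, levyArea, Sum.elim_inl, Sum.elim_inr, Complex.ofReal_zero,
    zero_smul, Finset.sum_const_zero, zero_add, add_zero]
  rw [← Finset.sum_add_distrib]
  refine Finset.sum_congr rfl fun n hn => ?_
  rw [Finset.sum_eq_single_of_mem n hn (fun m _ hm => by simp [Ne.symm hm]),
    Finset.sum_eq_single_of_mem n hn (fun m _ hm => by simp [Ne.symm hm])]
  simp [sub_eq_add_neg]

/-- Each n contributes the two entries ±1/n, so the squared Hilbert-Schmidt norm of a partial sum is
2 ∑ 1/n². -/
theorem summable_levyArea : Summable fun n : ℕ+ =>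
    (1 / (n : ℂ)) • (𝒜.tmul (ξ n) (η n) - 𝒜.tmul (η n) (ξ n)) := by
  refine NCProbSpace.summable_of_norm_sum_le (summable_one_div_sq.mul_left 2)
    (C := 4) fun F => ?_
  rw [← sum_levyArea_smul h𝒜 h hs]
  refine (𝒜.norm_sum_tensorOp_le h𝒜 h hs _ _).trans_eq ?_
  congr 2
  simp only [Finset.sum_disjSum, levyArea]
  simp [ite_pow, Finset.sum_ite_eq]
  rw [← Finset.mul_sum, two_mul]

theorem isSecondSignature_levyArea :
    𝒜.IsSecondSignature (𝒜.levyBridge ξ η) (2 * Real.pi)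
      (∑' n : ℕ+, (1 / (n : ℂ)) • (𝒜.tmul (ξ n) (η n) - 𝒜.tmul (η n) (ξ n))) := by
  intro ε hε
  -- Chosen so that 4 (2πδ)^(1/2) = ε/2. The spare half restores strictness, since the limit over
  -- truncations preserves only ≤.
  set δ : ℝ := (ε / 8) ^ 2 / (2 * Real.pi) with hδ
  refine ⟨δ, by positivity, fun n τ hτ h0 hn hmesh => ?_⟩
  have hmem : ∀ k ≤ n, τ k ∈ Set.Icc 0 (2 * Real.pi) := fun k hk =>
    ⟨h0 ▸ hτ (Nat.zero_le k), hn ▸ hτ hk⟩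
  set x : Finset ℕ+ → ℕ → 𝒜.Var := fun F k =>
    linComb (F.disjSum F) (Sum.elim ξ η) (levyCoeff (τ k)) with hx
  have hxlim : ∀ k ≤ n, Filter.Tendsto (fun F => x F k) Filter.atTop
      (nhds (𝒜.levyBridge ξ η (τ k))) := fun k hk => tendsto_levyBridge h𝒜 h hs (hmem k hk)
  have hlim : Filter.Tendsto (fun F => (∑ k ∈ Finset.range n,
      𝒜.tmul (x F k) (x F (k + 1) - x F k)) -
        ∑ n ∈ F, (1 / (n : ℂ)) • (𝒜.tmul (ξ n) (η n) - 𝒜.tmul (η n) (ξ n))) Filter.atTop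
      (nhds ((∑ k ∈ Finset.range n, 𝒜.tmul (𝒜.levyBridge ξ η (τ k))
        (𝒜.levyBridge ξ η (τ (k + 1)) - 𝒜.levyBridge ξ η (τ k))) -
        ∑' n : ℕ+, (1 / (n : ℂ)) • (𝒜.tmul (ξ n) (η n) - 𝒜.tmul (η n) (ξ n)))) := by
    refine Filter.Tendsto.sub (tendsto_finsetSum _ fun k hk => ?_)
      (summable_levyArea h𝒜 h hs).hasSum
    rw [Finset.mem_range] at hk
    have hp := (hxlim k hk.le).prodMk_nhds ((hxlim (k + 1) hk).sub (hxlim k hk.le))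
    have hc := (𝒜.continuous_tmul.tendsto _).comp hp
    exact hc
  -- The bridge and the area series are truncated at the same `F`, so their difference is governed
  -- by one finite matrix whose Hilbert-Schmidt bound does not depend on `F`.
  have hle : ∀ F, ‖(∑ k ∈ Finset.range n, 𝒜.tmul (x F k) (x F (k + 1) - x F k)) -
        ∑ n ∈ F, (1 / (n : ℂ)) • (𝒜.tmul (ξ n) (η n) - 𝒜.tmul (η n) (ξ n))‖ ≤ ε / 2 := by
    intro F
    have e : (∑ k ∈ Finset.range n, 𝒜.tmul (x F k) (x F (k + 1) - x F k)) -
        ∑ n ∈ F, (1 / (n : ℂ)) • (𝒜.tmul (ξ n) (η n) - 𝒜.tmul (η n) (ξ n)) =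
        ∑ i ∈ F.disjSum F, ∑ j ∈ F.disjSum F, ((∑ k ∈ Finset.range n,
          levyCoeff (τ k) i * (levyCoeff (τ (k + 1)) j - levyCoeff (τ k) j) - levyArea i j : ℝ) : ℂ) •
            𝒜.tmul (Sum.elim ξ η i) (Sum.elim ξ η j) := by
      rw [← sum_levyArea_smul h𝒜 h hs]
      have e1 : ∀ k, x F (k + 1) - x F k = linComb (F.disjSum F) (Sum.elim ξ η)
          fun j => levyCoeff (τ (k + 1)) j - levyCoeff (τ k) j := fun k => by
        simp only [hx, linComb, ← Finset.sum_sub_distrib, ← sub_smul, Complex.ofReal_sub]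
      have e2 : ∑ k ∈ Finset.range n, 𝒜.tmul (x F k) (x F (k + 1) - x F k) =
          ∑ i ∈ F.disjSum F, ∑ j ∈ F.disjSum F, ∑ k ∈ Finset.range n,
            ((levyCoeff (τ k) i * (levyCoeff (τ (k + 1)) j - levyCoeff (τ k) j) : ℝ) : ℂ) •
              𝒜.tmul (Sum.elim ξ η i) (Sum.elim ξ η j) := by
        simp only [e1]
        simp only [hx, NCProbSpace.tmul_linComb]
        rw [Finset.sum_comm]
        exact Finset.sum_congr rfl fun i _ => Finset.sum_comm
      simp only [e2, ← Finset.sum_sub_distrib, ← Finset.sum_smul, ← sub_smul,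
        ← Complex.ofReal_sum, ← Complex.ofReal_sub]
    rw [e]
    refine (𝒜.norm_sum_tensorOp_le h𝒜 h hs _ _).trans ?_
    have h1 := sum_levyArea_sub_sq_le F n τ hτ h0 hn hmesh
    have h2 : 2 * Real.pi * δ = (ε / 8) ^ 2 := by rw [hδ]; field_simp
    rw [h2] at h1
    calc _ ≤ 4 * √((ε / 8) ^ 2) := by gcongr
      _ = ε / 2 := by rw [Real.sqrt_sq (by positivity)]; ring
  exact (le_of_tendsto' hlim.norm hle).trans_lt (by linarith)

end Bridge

end Assembly

end FreeBridge

end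

theorem mainTheorem10 {H : Type*} [NormedAddCommGroup H] [InnerProductSpace ℂ H] [CompleteSpace H]
    (𝒜 : FreeBridge.NCProbSpace H) (h𝒜 : 𝒜.IsFaithful)
    (ξ η : ℕ+ → 𝒜.Var)
    (hfree : 𝒜.Free (Sum.elim ξ η))
    (hξ : ∀ n, 𝒜.IsStandardSemicircular (ξ n))
    (hη : ∀ n, 𝒜.IsStandardSemicircular (η n)) :
    (∀ t ∈ Set.Icc (0 : ℝ) (2 * Real.pi),
      Summable (𝒜.levyCosTerm ξ t) ∧ Summable (𝒜.levySinTerm η t)) ∧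
    𝒜.IsFreeBrownianBridge (2 * Real.pi) (𝒜.levyBridge ξ η) ∧
    ∃ Z : 𝒜.TensorVar,
      𝒜.IsSecondSignature (𝒜.levyBridge ξ η) (2 * Real.pi) Z ∧
      HasSum (fun n : ℕ+ =>
        (1 / (n : ℂ)) • (𝒜.tmul (ξ n) (η n) - 𝒜.tmul (η n) (ξ n))) Z := by
  have hss : ∀ i, 𝒜.IsStandardSemicircular (Sum.elim ξ η i) := by
    rintro (n | n)
    exacts [hξ n, hη n]
  have h : FreeBridge.IsFockFamily 𝒜.state (Sum.elim ξ η) :=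
    FreeBridge.NCProbSpace.Free.isFockFamily hfree hss
  have hs : ∀ i, IsSelfAdjoint (Sum.elim ξ η i) := fun i => (hss i).1
  exact ⟨fun t ht => FreeBridge.summable_levyTerms h𝒜 h hs ht,
    FreeBridge.isFreeBrownianBridge_levyBridge h𝒜 h hs, _,
    FreeBridge.isSecondSignature_levyArea h𝒜 h hs,
    (FreeBridge.summable_levyArea h𝒜 h hs).hasSum⟩
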